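/- Let $\mathcal A$ be a unital $C^\ast$-algebra and let $\mathcal A_{\mathbb Z}=\mathcal A^{\otimes\mathbb Z}$ be its infinite $C^\ast$-tensor power, i.e. the completion of the algebraic tensor power (the span of the monomials $\bigotimes_{n\in\mathbb Z}a_n$ with $a_n=1$ for all but finitely many $n$) in its maximal $C^\ast$-norm; if $\mathcal A$ is nuclear, this is the only $C^\ast$-tensor norm. Let $\mathcal A_R$ and $\mathcal A_L$ be the $C^\ast$-subalgebras generated by the sites $j\ge 1$ and $j\le 0$. Let $\omega$ be a state on $\mathcal A_{\mathbb Z}$ (not necessarily shift invariant), let $$\mathcal K_\omega=\{a\in\mathcal A_R:\ \omega(xa)=0\ \text{ for all }x\in\mathcal A_L\}$$ be its entanglement kernel, $\mathcal B_\omega=\mathcal A_R/\mathcal K_\omega$ the reduced space with the involution $(a+\mathcal K_\omega)^\ast=a^\ast+\mathcal K_\omega$, $q:\mathcal A_R\to\mathcal B_\omega$ the quotient map, $e=1+\mathcal K_\omega$, and $$\mathcal C_n=\big\{[a_{ij}+\mathcal K_\omega]\in M_n(\mathcal B_\omega):\ \forall\epsilon>0\ \exists k_{ij}\in\mathcal K_\omega\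 \text{ with }\ \epsilon\,1\otimes I_n+[a_{ij}+k_{ij}]\in M_n(\mathcal A_R)^+\big\}.$$ For $X\in M_n(\mathcal B_\omega)$ put $\|X\|_n^{\rm osy}=\inf\Big\{r\ge 0:\ \begin{pmatrix} r\,I_n\otimes e& X\\ X^\ast& r\,I_n\otimes e\end{pmatrix}\in\mathcal C_{2n}\Big\}$. By an operator system in a unital $C^\ast$-algebra we mean a (not necessarily closed) self-adjoint linear subspace containing the unit. Then: 1. $(\mathcal B_\omega,\{\mathcal C_n\}_{n\ge1})$ is a matrix-ordered $\ast$-vector space (each $\mathcal C_n$ is a cone of hermitian matrices with $\mathcal C_n\cap(-\mathcal C_n)=\{0\}$, and $A^\ast\mathcal C_nA\subseteq\mathcal C_m$ for every scalar $n\times m$ matrix $A$), and $e$ is an Archimedean matrix order unit for it: for every $n$ and every hermitian $X\in M_n(\mathcal B_\omega)$ there is $r>0$ with $r\,I_n\otimes e-X\in\mathcal C_n$, and $X\in\mathcal C_n$ whenever $r\,I_n\otimes e+X\in\mathcal C_n$ for all $r>0$. 2. The quotient map $q$ is unital and completely positive. 3. There are a Hilbert space $H$, an operator system $\mathcal S\subseteq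 B(H)$ and a $\ast$-preserving complete order isomorphism $\varphi:\mathcal B_\omega\to\mathcal S$ with $\varphi(e)=I_H$ (where $\mathcal S$ carries the matrix order inherited from $B(H)$). Moreover $\|\varphi(b)\|=\|b\|_1^{\rm osy}$ for all $b\in\mathcal B_\omega$, and more generally $\|[\varphi(b_{ij})]\|_{M_n(B(H))}=\|[b_{ij}]\|_n^{\rm osy}$ for all $n$ and $[b_{ij}]\in M_n(\mathcal B_\omega)$. 4. If $\mathcal T$ is an abstract operator system (a matrix-ordered $\ast$-vector space with an Archimedean matrix order unit) and $\phi:\mathcal A_R\to\mathcal T$ is a unital completely positive map with $\mathcal K_\omega\subseteq\operatorname{Ker}\phi$, then $\bar\phi:\mathcal B_\omega\to\mathcal T$, $\bar\phi(a+\mathcal K_\omega)=\phi(a)$, is unital and completely positive. 5. In particular the reduced functional $\bar\omega:\mathcal B_\omega\to\mathbb C$, $\bar\omega(a+\mathcal K_\omega)=\omega(a)$, is unital and completely positive, hence a state: $\bar\omega\ge0$ on $\mathcal C_1$, $\bar\omega(e)=1$ and $|\bar\omega(b)|\le\|b\|_1^{\rm osy}$ for all $b$. -/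

import Mathlib

open scoped ComplexOrder TensorProduct

universe u v

noncomputable section

namespace SpinChain

/-! ## The involution on the algebraic tensor power -/

section PiStar

variable {A : Type u} [CStarAlgebra A]

/-- The additive map `c • ⨂ aᵢ ↦ conj c • ⨂ aᵢ⋆`. -/
def piStarHom (A : Type u) [CStarAlgebra A] :
    (⨂[ℂ] _ : ℤ, A) →+ (⨂[ℂ] _ : ℤ, A) :=
  PiTensorProduct.liftAddHom
    (fun z => star z.1 • PiTensorProduct.tprod ℂ (fun i => star (z.2 i)))
    (by
      intro r f i hf
      have h : (PiTensorProduct.tprod ℂ (fun i => star (f i)) : ⨂[ℂ] _ : ℤ, A) = 0 :=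
        (PiTensorProduct.tprod ℂ).map_coord_zero i (by simp [hf])
      simp [h])
    (by intro f; simp)
    (by
      intro hdec r f i m₁ m₂
      have key : ∀ m : A, (fun j => star (Function.update f i m j))
          = Function.update (fun j => star (f j)) i (star m) := by
        intro m; funext j; by_cases h : j = i
        · subst h; simp
        · simp [h]
      simp only [key, star_add, MultilinearMap.map_update_add, smul_add])
    (by intro r r' f; simp [add_smul])
    (by
      intro hdec r f i r'
      have key : (fun j => star (Function.update f i (r' • f i) j))
          = Function.update (fun j => star (f j)) i (star r' • star (f i)) := by
        funext j; by_cases h : j = i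
        · subst h; simp
        · simp [h]
      simp only [key, MultilinearMap.map_update_smul, smul_smul, star_mul', Function.update_eq_self]
      rw [mul_comm])

theorem piStarHom_smul_tprod (r : ℂ) (f : ℤ → A) :
    piStarHom A (r • PiTensorProduct.tprod ℂ f)
      = star r • PiTensorProduct.tprod ℂ (fun i => star (f i)) := by
  rw [← PiTensorProduct.tprodCoeff_eq_smul_tprod]
  rfl

instance piStarRing : StarRing (⨂[ℂ] _ : ℤ, A) where
  star := piStarHom A
  star_involutive x := by
    induction x using PiTensorProduct.induction_on with
    | smul_tprod r f => simp [piStarHom_smul_tprod]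
    | add x y hx hy => rw [map_add, map_add, hx, hy]
  star_add x y := map_add _ x y
  star_mul x y := by
    change piStarHom A (x * y) = piStarHom A y * piStarHom A x
    induction x using PiTensorProduct.induction_on with
    | smul_tprod r f =>
      induction y using PiTensorProduct.induction_on with
      | smul_tprod s g =>
        rw [PiTensorProduct.smul_tprod_mul_smul_tprod, piStarHom_smul_tprod,
          piStarHom_smul_tprod, piStarHom_smul_tprod, PiTensorProduct.smul_tprod_mul_smul_tprod]
        congr 1
        · simp [mul_comm]
        · congr 1; funext i; simp
      | add x y hx hy => rw [mul_add, map_add, map_add, add_mul, hx, hy]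
    | add x y hx hy => rw [add_mul, map_add, map_add, mul_add, hx, hy]

instance piStarModule : StarModule ℂ (⨂[ℂ] _ : ℤ, A) where
  star_smul c x := by
    change piStarHom A (c • x) = star c • piStarHom A x
    induction x using PiTensorProduct.induction_on with
    | smul_tprod r f => simp only [smul_smul, piStarHom_smul_tprod, star_mul']
    | add x y hx hy => rw [smul_add, map_add, map_add, smul_add, hx, hy]

end PiStar

/-! ## The algebraic infinite tensor power and its maximal C⋆-completion -/

/-- The algebraic infinite tensor power of `A` over the sites `ℤ`: inside the tensor product of
`ℤ` copies of `A`, the `⋆`-subalgebra generated by the elements `⋯ ⊗ 1 ⊗ a ⊗ 1 ⊗ ⋯`. It is spanned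
by the monomials `⨂ₙ aₙ` with `aₙ = 1` for all but finitely many `n`. -/
def algTensorPower (A : Type u) [CStarAlgebra A] : StarSubalgebra ℂ (⨂[ℂ] _ : ℤ, A) :=
  StarAlgebra.adjoin ℂ {y | ∃ (j : ℤ) (a : A), y = PiTensorProduct.singleAlgHom j a}

/-- The algebraic infinite tensor power as a type of its own (it will carry a seminorm). -/
def AlgChain (A : Type u) [CStarAlgebra A] : Type u := ↥(algTensorPower A)

section AlgChain

variable {A : Type u} [CStarAlgebra A]

instance : Ring (AlgChain A) := inferInstanceAs (Ring ↥(algTensorPower A))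
instance : StarRing (AlgChain A) := inferInstanceAs (StarRing ↥(algTensorPower A))
instance : Algebra ℂ (AlgChain A) := inferInstanceAs (Algebra ℂ ↥(algTensorPower A))
instance : StarModule ℂ (AlgChain A) := inferInstanceAs (StarModule ℂ ↥(algTensorPower A))

/-- The monomial `⋯ ⊗ 1 ⊗ a ⊗ 1 ⊗ ⋯` with `a` at the site `j`. -/
def algSite (j : ℤ) (a : A) : AlgChain A :=
  ⟨PiTensorProduct.singleAlgHom j a, StarAlgebra.subset_adjoin ℂ _ ⟨j, a, rfl⟩⟩

/-- C⋆-seminorms on the algebraic infinite tensor power. The last field is automatic, as `A` is a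
C⋆-algebra; it is listed because it makes the supremum of all of them visibly finite. -/
structure IsCStarSeminorm (p : AlgChain A → ℝ) : Prop where
  nonneg : ∀ x, 0 ≤ p x
  add_le : ∀ x y, p (x + y) ≤ p x + p y
  smul : ∀ (c : ℂ) x, p (c • x) = ‖c‖ * p x
  mul_le : ∀ x y, p (x * y) ≤ p x * p y
  star_mul_self : ∀ x, p (star x * x) = p x * p x
  site_le : ∀ (j : ℤ) (a : A), p (algSite j a) ≤ ‖a‖

theorem IsCStarSeminorm.star_eq {p : AlgChain A → ℝ} (hp : IsCStarSeminorm p) (x : AlgChain A) :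
    p (star x) = p x := by
  have h : ∀ y, p y ≤ p (star y) := by
    intro y
    rcases (hp.nonneg y).eq_or_lt with h0 | h0
    · rw [← h0]; exact hp.nonneg _
    · have h1 := hp.mul_le (star y) y
      rw [hp.star_mul_self] at h1
      exact le_of_mul_le_mul_right h1 h0
  refine le_antisymm ?_ (h x)
  simpa using h (star x)

variable (A) in
/-- The set of all C⋆-seminorms. -/
abbrev CStarSeminorms : Type u := {p : AlgChain A → ℝ // IsCStarSeminorm p}

instance : Nonempty (CStarSeminorms A) :=
  ⟨⟨fun _ => 0, by constructor <;> intros <;> simp⟩⟩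

theorem bddAbove_seminorms (x : AlgChain A) :
    BddAbove (Set.range fun p : CStarSeminorms A => p.1 x) := by
  suffices h : ∃ C : ℝ, ∀ p : CStarSeminorms A, p.1 x ≤ C by
    obtain ⟨C, hC⟩ := h
    exact ⟨C, by rintro _ ⟨p, rfl⟩; exact hC p⟩
  obtain ⟨x, hx⟩ := x
  induction hx using StarAlgebra.adjoin_induction with
  | mem y hy =>
    obtain ⟨j, a, rfl⟩ := hy
    exact ⟨‖a‖, fun p => p.2.site_le j a⟩
  | algebraMap c =>
    refine ⟨‖c • (1 : A)‖, fun p => ?_⟩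
    have h := p.2.site_le 0 (c • (1 : A))
    refine le_trans (le_of_eq ?_) h
    refine congrArg p.1 (Subtype.ext ?_)
    change _ = PiTensorProduct.singleAlgHom (A := fun _ : ℤ => A) 0 (c • (1 : A))
    exact (Algebra.algebraMap_eq_smul_one c).trans (by rw [map_smul, map_one])
  | add y z hy hz ihy ihz =>
    obtain ⟨C, hC⟩ := ihy
    obtain ⟨D, hD⟩ := ihz
    exact ⟨C + D, fun p => (p.2.add_le ⟨y, hy⟩ ⟨z, hz⟩).trans (add_le_add (hC p) (hD p))⟩
  | mul y z hy hz ihy ihz =>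
    obtain ⟨C, hC⟩ := ihy
    obtain ⟨D, hD⟩ := ihz
    refine ⟨C * D, fun p => (p.2.mul_le ⟨y, hy⟩ ⟨z, hz⟩).trans ?_⟩
    exact mul_le_mul (hC p) (hD p) (p.2.nonneg _) ((p.2.nonneg _).trans (hC p))
  | star y hy ihy =>
    obtain ⟨C, hC⟩ := ihy
    exact ⟨C, fun p => (p.2.star_eq ⟨y, hy⟩).le.trans (hC p)⟩

/-- The maximal C⋆-seminorm, the pointwise supremum of all C⋆-seminorms. -/
def maxSeminorm (x : AlgChain A) : ℝ := ⨆ p : CStarSeminorms A, p.1 x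

theorem le_maxSeminorm (p : CStarSeminorms A) (x : AlgChain A) : p.1 x ≤ maxSeminorm x :=
  le_ciSup (bddAbove_seminorms x) p

theorem maxSeminorm_nonneg (x : AlgChain A) : 0 ≤ maxSeminorm x :=
  Real.iSup_nonneg fun p => p.2.nonneg x

theorem isCStarSeminorm_max : IsCStarSeminorm (maxSeminorm (A := A)) where
  nonneg := maxSeminorm_nonneg
  add_le x y := ciSup_le fun p =>
    (p.2.add_le x y).trans (add_le_add (le_maxSeminorm p x) (le_maxSeminorm p y))
  smul c x := by
    unfold maxSeminorm
    rw [Real.mul_iSup_of_nonneg (norm_nonneg c)]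
    exact iSup_congr fun p => p.2.smul c x
  mul_le x y := ciSup_le fun p => (p.2.mul_le x y).trans
    (mul_le_mul (le_maxSeminorm p x) (le_maxSeminorm p y) (p.2.nonneg _) (maxSeminorm_nonneg _))
  star_mul_self x := by
    apply le_antisymm
    · exact ciSup_le fun p => (p.2.star_mul_self x).le.trans
        (mul_le_mul (le_maxSeminorm p x) (le_maxSeminorm p x) (p.2.nonneg _)
          (maxSeminorm_nonneg _))
    · have h : maxSeminorm x ≤ Real.sqrt (maxSeminorm (star x * x)) := by
        refine ciSup_le fun p => Real.le_sqrt_of_sq_le ?_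
        rw [sq, ← p.2.star_mul_self x]
        exact le_maxSeminorm p _
      calc maxSeminorm x * maxSeminorm x
          ≤ Real.sqrt (maxSeminorm (star x * x)) * Real.sqrt (maxSeminorm (star x * x)) :=
            mul_le_mul h h (maxSeminorm_nonneg _) (Real.sqrt_nonneg _)
        _ = maxSeminorm (star x * x) := Real.mul_self_sqrt (maxSeminorm_nonneg _)
  site_le j a := ciSup_le fun p => p.2.site_le j a

instance : SeminormedRing (AlgChain A) :=
  RingSeminorm.toSeminormedRing
    { toFun := maxSeminorm
      map_zero' := by simpa using isCStarSeminorm_max.smul (0 : ℂ) (0 : AlgChain A)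
      add_le' := isCStarSeminorm_max.add_le
      neg' := fun x => by simpa using isCStarSeminorm_max.smul (-1 : ℂ) x
      mul_le' := isCStarSeminorm_max.mul_le }

theorem algChain_norm_def (x : AlgChain A) : ‖x‖ = maxSeminorm x := rfl

instance : NormedAlgebra ℂ (AlgChain A) where
  norm_smul_le c x := (isCStarSeminorm_max.smul c x).le

instance : NormedStarGroup (AlgChain A) where
  norm_star_le x := (isCStarSeminorm_max.star_eq x).le

end AlgChain

/-- The algebra of observables `A^{⊗ℤ}` of the chain: the (Hausdorff) completion of the algebraic
infinite tensor power in its maximal C⋆-seminorm. For nuclear `A` this is the only C⋆-norm on the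
algebraic infinite tensor power. -/
def Chain (A : Type u) [CStarAlgebra A] : Type u := UniformSpace.Completion (AlgChain A)

section Chain

open UniformSpace

variable {A : Type u} [CStarAlgebra A]

instance : NormedRing (Chain A) := inferInstanceAs (NormedRing (Completion (AlgChain A)))
instance : CompleteSpace (Chain A) := inferInstanceAs (CompleteSpace (Completion (AlgChain A)))
instance : Algebra ℂ (Chain A) := inferInstanceAs (Algebra ℂ (Completion (AlgChain A)))
instance : NormedAlgebra ℂ (Chain A) where
  norm_smul_le := norm_smul_le (α := ℂ) (β := Completion (AlgChain A))

/-- The canonical map of the algebraic infinite tensor power into the chain algebra. -/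
def toChain (x : AlgChain A) : Chain A := (x : Completion (AlgChain A))

theorem toChain_induction {P : Chain A → Prop} (hc : IsClosed {x | P x})
    (h : ∀ x : AlgChain A, P (toChain x)) (x : Chain A) : P x :=
  Completion.induction_on (α := AlgChain A) x hc h

/-- The involution, extended by continuity. -/
def chainStar : Chain A → Chain A := Completion.map (star : AlgChain A → AlgChain A)

theorem continuous_chainStar : Continuous (chainStar (A := A)) :=
  Completion.continuous_map

theorem chainStar_coe (x : AlgChain A) : chainStar (toChain x) = toChain (star x) :=
  Completion.map_coe (NormedAddGroupHom.uniformContinuous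
    (starNormedAddGroupHom (E := AlgChain A))) x

theorem toChain_add (x y : AlgChain A) : toChain (x + y) = toChain x + toChain y :=
  Completion.coe_add x y

theorem toChain_mul (x y : AlgChain A) : toChain (x * y) = toChain x * toChain y :=
  Completion.coe_mul x y

theorem toChain_smul (c : ℂ) (x : AlgChain A) : toChain (c • x) = c • toChain x :=
  Completion.coe_smul c x

theorem norm_toChain (x : AlgChain A) : ‖toChain x‖ = ‖x‖ :=
  Completion.norm_coe x

instance : StarRing (Chain A) where
  star := chainStar
  star_involutive x := by
    induction x using toChain_induction with
    | hc => exact isClosed_eq (continuous_chainStar.comp continuous_chainStar) continuous_id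
    | h x => rw [chainStar_coe, chainStar_coe, star_star]
  star_add x y := by
    change chainStar (x + y) = chainStar x + chainStar y
    induction x using toChain_induction with
    | hc => exact isClosed_eq (continuous_chainStar.comp (by fun_prop))
              (continuous_chainStar.add continuous_const)
    | h x =>
      induction y using toChain_induction with
      | hc => exact isClosed_eq (continuous_chainStar.comp (by fun_prop))
                (continuous_const.add continuous_chainStar)
      | h y => rw [← toChain_add, chainStar_coe, chainStar_coe, chainStar_coe, star_add,
                toChain_add]
  star_mul x y := by
    change chainStar (x * y) = chainStar y * chainStar x
    induction x using toChain_induction with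
    | hc => exact isClosed_eq (continuous_chainStar.comp (by fun_prop))
              (continuous_const.mul continuous_chainStar)
    | h x =>
      induction y using toChain_induction with
      | hc => exact isClosed_eq (continuous_chainStar.comp (by fun_prop))
                (continuous_chainStar.mul continuous_const)
      | h y => rw [← toChain_mul, chainStar_coe, chainStar_coe, chainStar_coe, star_mul,
                toChain_mul]

theorem star_toChain (x : AlgChain A) : star (toChain x) = toChain (star x) := chainStar_coe x

instance : ContinuousStar (Chain A) := ⟨continuous_chainStar⟩

instance : StarModule ℂ (Chain A) where
  star_smul c x := by
    induction x using toChain_induction with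
    | hc => exact isClosed_eq (continuous_star.comp (continuous_const_smul c))
              ((continuous_const_smul (star c)).comp continuous_star)
    | h x => rw [← toChain_smul, star_toChain, star_toChain, star_smul, toChain_smul]

instance : CStarRing (Chain A) where
  norm_mul_self_le x := by
    induction x using toChain_induction with
    | hc => exact isClosed_le (by fun_prop) (by fun_prop)
    | h x =>
      rw [star_toChain, ← toChain_mul, norm_toChain, norm_toChain]
      exact (isCStarSeminorm_max.star_mul_self x).ge

instance : CStarAlgebra (Chain A) where

/-- The copy `α_j⁻¹(a)` in the chain algebra of the local observable `a`, at the site `j`. -/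
def site (j : ℤ) (a : A) : Chain A := toChain (algSite j a)

theorem site_commute {i j : ℤ} (h : i ≠ j) (a b : A) : Commute (site i a) (site j b) := by
  change toChain _ * toChain _ = toChain _ * toChain _
  rw [← toChain_mul, ← toChain_mul]
  refine congrArg toChain (Subtype.ext ?_)
  exact Commute.tprod (Pi.mulSingle_commute (f := fun _ : ℤ => A) h a b)

theorem star_site (j : ℤ) (a : A) : star (site j a) = site j (star a) := by
  rw [site, site, star_toChain]
  refine congrArg toChain (Subtype.ext ?_)
  change piStarHom A (PiTensorProduct.tprod ℂ _) = PiTensorProduct.tprod ℂ _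
  rw [← one_smul ℂ (PiTensorProduct.tprod ℂ _), piStarHom_smul_tprod, star_one, one_smul]
  congr 1
  funext i
  by_cases h : i = j
  · subst h; simp
  · simp [Pi.mulSingle_eq_of_ne h]

end Chain

/-! ## Half-chains, states, and the entanglement kernel -/

section Kernel

variable {A : Type u} [CStarAlgebra A]

/-- The C⋆-subalgebra of the chain algebra generated by the sites in `I`. -/
def sitesAlgebra (A : Type u) [CStarAlgebra A] (I : Set ℤ) : StarSubalgebra ℂ (Chain A) :=
  (StarAlgebra.adjoin ℂ {y | ∃ j ∈ I, ∃ a : A, y = site j a}).topologicalClosure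

/-- The right half-chain `A_R`, on the sites `j ≥ 1`. -/
abbrev rightHalf (A : Type u) [CStarAlgebra A] : StarSubalgebra ℂ (Chain A) :=
  sitesAlgebra A (Set.Ici 1)

/-- The left half-chain `A_L`, on the sites `j ≤ 0`. -/
abbrev leftHalf (A : Type u) [CStarAlgebra A] : StarSubalgebra ℂ (Chain A) :=
  sitesAlgebra A (Set.Iic 0)

instance (I : Set ℤ) : IsClosed (sitesAlgebra A I : Set (Chain A)) :=
  StarSubalgebra.isClosed_topologicalClosure _

theorem sitesAlgebra_commute {I J : Set ℤ} (hIJ : Disjoint I J) {x y : Chain A}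
    (hx : x ∈ sitesAlgebra A I) (hy : y ∈ sitesAlgebra A J) : x * y = y * x := by
  have step : ∀ (S : Set (Chain A)) (K : Set ℤ),
      (∀ j ∈ K, ∀ a : A, ∀ s ∈ S, s * site j a = site j a * s ∧
        star s * site j a = site j a * star s) →
      sitesAlgebra A K ≤ StarSubalgebra.centralizer ℂ S := by
    intro S K h
    refine StarSubalgebra.topologicalClosure_minimal (StarAlgebra.adjoin_le ?_) ?_
    · rintro _ ⟨j, hj, a, rfl⟩
      exact StarSubalgebra.mem_centralizer_iff ℂ |>.2 fun s hs => h j hj a s hs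
    · rw [StarSubalgebra.coe_centralizer]
      exact Set.isClosed_centralizer _
  have h1 : sitesAlgebra A J ≤ StarSubalgebra.centralizer ℂ (sitesAlgebra A I : Set (Chain A)) := by
    apply step
    intro j hj a s hs
    have h2 : sitesAlgebra A I ≤ StarSubalgebra.centralizer ℂ {site j a} := by
      apply step
      rintro i hi b _ rfl
      have hij : j ≠ i := fun h => Set.disjoint_left.1 hIJ hi (h ▸ hj)
      refine ⟨site_commute hij a b, ?_⟩
      rw [star_site]
      exact site_commute hij (star a) b
    have h3 : ∀ t ∈ sitesAlgebra A I, t * site j a = site j a * t := fun t ht =>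
      ((StarSubalgebra.mem_centralizer_iff ℂ).1 (h2 ht) _ rfl).1.symm
    exact ⟨h3 s hs, h3 _ (star_mem hs)⟩
  exact ((StarSubalgebra.mem_centralizer_iff ℂ).1 (h1 hy) x hx).1

theorem left_right_commute {x y : Chain A} (hx : x ∈ leftHalf A) (hy : y ∈ rightHalf A) :
    x * y = y * x := by
  refine sitesAlgebra_commute (Set.disjoint_left.2 fun j h0 h1 => ?_) hx hy
  have h0' : j ≤ 0 := h0
  have h1' : 1 ≤ j := h1
  omega

/-- States of a unital C⋆-algebra: bounded linear functionals that are positive and unital. -/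
structure CState (𝔄 : Type u) [CStarAlgebra 𝔄] where
  toFun : 𝔄 →L[ℂ] ℂ
  nonneg : ∀ a, 0 ≤ toFun (star a * a)
  map_one : toFun 1 = 1

theorem CState.map_star {𝔄 : Type u} [CStarAlgebra 𝔄] (ω : CState 𝔄) (a : 𝔄) :
    ω.toFun (star a) = star (ω.toFun a) := by
  have key : ∀ c : ℂ, (star c * ω.toFun (star a) + c * ω.toFun a).im = 0 := by
    intro c
    have h1 := ω.nonneg (c • a + 1)
    have h2 := ω.nonneg (c • a)
    have e : star (c • a + 1) * (c • a + 1)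
        = star (c • a) * (c • a) + (star c • star a + c • a) + 1 := by
      rw [star_add, star_one, star_smul, add_mul, mul_add, mul_one, one_mul]
      abel
    rw [e, map_add, map_add, ω.map_one, map_add, map_smul, map_smul] at h1
    have h1' := (Complex.le_def.1 h1).2
    have h2' := (Complex.le_def.1 h2).2
    simp only [Complex.add_im, Complex.zero_im, Complex.one_im, smul_eq_mul] at h1' h2'
    rw [Complex.add_im]
    linarith
  have k1 := key 1
  have kI := key Complex.I
  simp at k1 kI
  apply Complex.ext
  · simp; linarith
  · simp; linarith

/-- The entanglement kernel `K_ω = {a ∈ A_R | ω(x a) = 0 for all x ∈ A_L}`. -/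
def entKernel (ω : CState (Chain A)) : Submodule ℂ (rightHalf A) where
  carrier := {a | ∀ x ∈ leftHalf A, ω.toFun (x * (a : Chain A)) = 0}
  zero_mem' := by intro x _; simp
  add_mem' := by
    intro a b ha hb x hx
    simp [mul_add, ha x hx, hb x hx]
  smul_mem' := by
    intro c a ha x hx
    simp [ha x hx]

theorem star_mem_entKernel (ω : CState (Chain A)) {a : rightHalf A} (ha : a ∈ entKernel ω) :
    star a ∈ entKernel ω := by
  intro x hx
  have h := ha (star x) (star_mem hx)
  have e : x * ((star a : rightHalf A) : Chain A) = star (star x * (a : Chain A)) := by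
    rw [star_mul, star_star]
    exact left_right_commute hx (star a).2
  rw [e, ω.map_star, h, star_zero]

/-- The reduced space `B_ω = A_R / K_ω`. -/
def Reduced (ω : CState (Chain A)) : Type u := rightHalf A ⧸ entKernel ω

instance (ω : CState (Chain A)) : AddCommGroup (Reduced ω) :=
  inferInstanceAs (AddCommGroup (rightHalf A ⧸ entKernel ω))
instance (ω : CState (Chain A)) : Module ℂ (Reduced ω) :=
  inferInstanceAs (Module ℂ (rightHalf A ⧸ entKernel ω))

/-- The quotient map `q : A_R → B_ω`. -/
def quotMap (ω : CState (Chain A)) : rightHalf A →ₗ[ℂ] Reduced ω := (entKernel ω).mkQ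

theorem quotMap_surjective (ω : CState (Chain A)) : Function.Surjective (quotMap ω) :=
  Submodule.mkQ_surjective _

theorem quotMap_eq_iff (ω : CState (Chain A)) (a b : rightHalf A) :
    quotMap ω a = quotMap ω b ↔ a - b ∈ entKernel ω :=
  Submodule.Quotient.eq _

/-- The involution of the reduced space, `(a + K_ω)⋆ = a⋆ + K_ω`. -/
def reducedStar (ω : CState (Chain A)) : Reduced ω → Reduced ω :=
  Quotient.map' (s₁ := (entKernel ω).quotientRel) (s₂ := (entKernel ω).quotientRel) star
    (by
      intro a b h
      rw [Submodule.quotientRel_def] at h ⊢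
      rw [← star_sub]
      exact star_mem_entKernel ω h)

theorem reducedStar_quotMap (ω : CState (Chain A)) (a : rightHalf A) :
    reducedStar ω (quotMap ω a) = quotMap ω (star a) := rfl

instance (ω : CState (Chain A)) : StarAddMonoid (Reduced ω) where
  star := reducedStar ω
  star_involutive x := by
    obtain ⟨a, rfl⟩ := quotMap_surjective ω x
    rw [reducedStar_quotMap, reducedStar_quotMap, star_star]
  star_add x y := by
    obtain ⟨a, rfl⟩ := quotMap_surjective ω x
    obtain ⟨b, rfl⟩ := quotMap_surjective ω y
    change reducedStar ω _ = reducedStar ω _ + reducedStar ω _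
    rw [← map_add, reducedStar_quotMap, reducedStar_quotMap, reducedStar_quotMap, star_add,
      map_add]

instance (ω : CState (Chain A)) : StarModule ℂ (Reduced ω) where
  star_smul c x := by
    obtain ⟨a, rfl⟩ := quotMap_surjective ω x
    change reducedStar ω _ = star c • reducedStar ω _
    rw [← map_smul, reducedStar_quotMap, reducedStar_quotMap, star_smul, map_smul]

/-- The unit `e = 1 + K_ω`. -/
def reducedUnit (ω : CState (Chain A)) : Reduced ω := quotMap ω 1

/-- The map `B_ω → T` induced by a linear map `φ : A_R → T` that vanishes on `K_ω`. -/
def descend (ω : CState (Chain A)) {T : Type v} [AddCommGroup T] [Module ℂ T]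
    (φ : rightHalf A →ₗ[ℂ] T) (hφ : ∀ k ∈ entKernel ω, φ k = 0) : Reduced ω →ₗ[ℂ] T :=
  (entKernel ω).liftQ φ hφ

/-- The restriction `ω_R` of `ω` to `A_R`. -/
def restrictRight (ω : CState (Chain A)) : rightHalf A →ₗ[ℂ] ℂ where
  toFun a := ω.toFun (a : Chain A)
  map_add' a b := by simp
  map_smul' c a := by simp

theorem restrictRight_entKernel (ω : CState (Chain A)) :
    ∀ k ∈ entKernel ω, restrictRight ω k = 0 := by
  intro k hk
  have h := hk 1 (one_mem _)
  rw [one_mul] at h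
  exact h

/-- The reduced functional `ω̄ : B_ω → ℂ`, `ω̄(a + K_ω) = ω(a)`. -/
def reducedFunctional (ω : CState (Chain A)) : Reduced ω →ₗ[ℂ] ℂ :=
  descend ω (restrictRight ω) (restrictRight_entKernel ω)

end Kernel

/-! ## Matrix-ordered `⋆`-vector spaces and operator systems -/

section MatrixOrder

/-- A family of sets of matrices `C n ⊆ M_n(V)`. -/
abbrev MatrixCones (V : Type u) : Type u := ∀ n : ℕ, Set (Matrix (Fin n) (Fin n) V)

/-- `A⋆ X A ∈ M_m(V)` for a scalar matrix `A` of size `n × m` and `X ∈ M_n(V)`. -/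
def compression {V : Type u} [AddCommGroup V] [Module ℂ V] {n m : ℕ}
    (A : Matrix (Fin n) (Fin m) ℂ) (X : Matrix (Fin n) (Fin n) V) : Matrix (Fin m) (Fin m) V :=
  fun i j => ∑ k, ∑ l, (star (A k i) * A l j) • X k l

/-- `I_n ⊗ e`. -/
def ampUnit {V : Type u} [AddCommGroup V] (e : V) (n : ℕ) : Matrix (Fin n) (Fin n) V :=
  Matrix.diagonal fun _ => e

/-- `V` is a matrix-ordered `⋆`-vector space with the matrix cones `C`. -/
structure IsMatrixOrdered {V : Type u} [AddCommGroup V] [Module ℂ V] [StarAddMonoid V]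
    [StarModule ℂ V] (C : MatrixCones V) : Prop where
  hermitian : ∀ n, ∀ X ∈ C n, X.conjTranspose = X
  zero_mem : ∀ n, (0 : Matrix (Fin n) (Fin n) V) ∈ C n
  add_mem : ∀ n, ∀ X ∈ C n, ∀ Y ∈ C n, X + Y ∈ C n
  smul_mem : ∀ n, ∀ r : ℝ, 0 ≤ r → ∀ X ∈ C n, (r : ℂ) • X ∈ C n
  proper : ∀ n, ∀ X ∈ C n, -X ∈ C n → X = 0
  compression_mem : ∀ (n m : ℕ) (A : Matrix (Fin n) (Fin m) ℂ), ∀ X ∈ C n,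
    compression A X ∈ C m

/-- The hermitian element `e` is a matrix order unit: for each `n`, every hermitian `X ∈ M_n(V)`
satisfies `X ≤ r (I_n ⊗ e)` for some `r > 0`. -/
def IsMatrixOrderUnit {V : Type u} [AddCommGroup V] [Module ℂ V] [StarAddMonoid V]
    (C : MatrixCones V) (e : V) : Prop :=
  star e = e ∧ ∀ (n : ℕ) (X : Matrix (Fin n) (Fin n) V), X.conjTranspose = X →
    ∃ r : ℝ, 0 < r ∧ (r : ℂ) • ampUnit e n - X ∈ C n

/-- `e` is an Archimedean matrix order unit: moreover `X ∈ M_n(V)` hermitian is in the cone as soon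
as `r (I_n ⊗ e) + X` is in the cone for all `r > 0`. -/
def IsArchimedeanMatrixOrderUnit {V : Type u} [AddCommGroup V] [Module ℂ V] [StarAddMonoid V]
    (C : MatrixCones V) (e : V) : Prop :=
  IsMatrixOrderUnit C e ∧ ∀ (n : ℕ) (X : Matrix (Fin n) (Fin n) V), X.conjTranspose = X →
    (∀ r : ℝ, 0 < r → (r : ℂ) • ampUnit e n + X ∈ C n) → X ∈ C n

/-- Complete positivity of a linear map, with respect to matrix cones on both sides. -/
def IsCompletelyPositive {V : Type u} {W : Type v} [AddCommGroup V] [Module ℂ V]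
    [AddCommGroup W] [Module ℂ W] (C : MatrixCones V) (D : MatrixCones W) (φ : V →ₗ[ℂ] W) : Prop :=
  ∀ n, ∀ X ∈ C n, X.map φ ∈ D n

/-- The positive cones `M_n(𝔄)⁺ = {Y⋆ Y}` of a C⋆-algebra `𝔄`. -/
def cstarCones (𝔄 : Type u) [Ring 𝔄] [StarRing 𝔄] : MatrixCones 𝔄 :=
  fun n => {X | ∃ Y : Matrix (Fin n) (Fin n) 𝔄, X = Y.conjTranspose * Y}

/-- The matrix norms of an abstract operator system with cones `C` and unit `e`:
`‖X‖_n` is the infimum of the `r ≥ 0` for which the `2 × 2` block matrix with rows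
`(r (I_n ⊗ e), X)` and `(X⋆, r (I_n ⊗ e))` is in the cone of `M_{2n}(V)`. -/
def orderNorm {V : Type u} [AddCommGroup V] [Module ℂ V] [StarAddMonoid V]
    (C : MatrixCones V) (e : V) (n : ℕ) (X : Matrix (Fin n) (Fin n) V) : ℝ :=
  sInf {r : ℝ | 0 ≤ r ∧
    Matrix.reindex finSumFinEquiv finSumFinEquiv
      (Matrix.fromBlocks ((r : ℂ) • ampUnit e n) X X.conjTranspose ((r : ℂ) • ampUnit e n))
      ∈ C (n + n)}

/-- A functional on an operator system is a state if it is positive, unital, and bounded for the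
order norm. -/
def IsOperatorSystemState {V : Type u} [AddCommGroup V] [Module ℂ V] [StarAddMonoid V]
    (C : MatrixCones V) (e : V) (f : V →ₗ[ℂ] ℂ) : Prop :=
  (∀ b : V, Matrix.of (fun _ _ : Fin 1 => b) ∈ C 1 → 0 ≤ f b) ∧ f e = 1 ∧
    ∀ b : V, ‖f b‖ ≤ orderNorm C e 1 (Matrix.of fun _ _ => b)

/-- Operator systems in a unital C⋆-algebra: self-adjoint linear subspaces containing the unit. -/
def IsOperatorSystem {𝔄 : Type u} [CStarAlgebra 𝔄] (S : Submodule ℂ 𝔄) : Prop :=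
  (1 : 𝔄) ∈ S ∧ ∀ a ∈ S, star a ∈ S

/-- The matrix cones `M_n(S) ∩ M_n(𝔄)⁺` of a linear subspace `S ⊆ 𝔄`. -/
def inheritedCones {𝔄 : Type u} [CStarAlgebra 𝔄] (S : Submodule ℂ 𝔄) : MatrixCones S :=
  fun n => {X | X.map (fun s : S => (s : 𝔄)) ∈ cstarCones 𝔄 n}

end MatrixOrder

/-! ## The Archimedeanized cones on the reduced space -/

/-- The cones `C_n` on `M_n(B_ω)`: the classes `[a_ij + K_ω]` such that for every `ε > 0` there are
`k_ij ∈ K_ω` with `ε 1 ⊗ I_n + [a_ij + k_ij] ∈ M_n(A_R)⁺`. -/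
def reducedCones {A : Type u} [CStarAlgebra A] (ω : CState (Chain A)) : MatrixCones (Reduced ω) :=
  fun n => {X | ∃ a : Matrix (Fin n) (Fin n) (rightHalf A), X = a.map (quotMap ω) ∧
    ∀ ε : ℝ, 0 < ε → ∃ k : Matrix (Fin n) (Fin n) (rightHalf A), (∀ i j, k i j ∈ entKernel ω) ∧
      (ε : ℂ) • ampUnit 1 n + (a + k) ∈ cstarCones (rightHalf A) n}

end SpinChain

end

/-! Everything except properness of the cones is general operator system theory; properness is where
the chain enters. For `x` a column in `A_L` and `a = Y⋆Y` over `A_R`, the two halves commute, so `∑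
ω(xᵢ⋆ xⱼ aᵢⱼ) = ∑ₖ ω(zₖ⋆ zₖ) ≥ 0` with `zₖ = ∑ᵢ Yₖᵢ xᵢ` (`leftForm_nonneg`). This form sees `a` only
modulo `K_ω`, so letting `ε → 0` it is nonnegative on `C_n`. If `±X ∈ C_n` the form vanishes, and
polarization puts every entry of a lift of `X` in `K_ω`. The remaining axioms come from positivity
in `M_n(A_R)`, with the `ε` of the definition absorbing the Archimedean limit.

The concrete representation is the Choi–Effros theorem, `exists_completeOrderEmbedding`. A
functional `s` on `M_n(V)` that is positive on the cone gives sesquilinear forms `(v, w) ↦ s [conj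
vᵢ wⱼ b]` on `ℂⁿ`, one for each `b`. Their direct sum over all `n` and `s` is completely positive
because cones are stable under compression. The form of `e` becomes the inner product of a Hilbert
space, and the form of `b` an operator `φ b` on it. By `exists_positive_functional` there are enough
`s` to detect every hermitian matrix outside a cone, so `φ` reflects positivity.

Norms are read off from the order: `‖T‖ ≤ r` exactly when the block matrix with rows `(r, T)` and
`(T⋆, r)` is positive. A complete order embedding therefore preserves matrix norms. Descent of maps
uses approximately positive lifts and the Archimedean property of the target; the reduced functional
is the case of target `ℂ`. -/

open scoped InnerProductSpace

namespace SpinChain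

/-! ### Matrix cones of a C⋆-algebra and the `2 × 2` description of the norm. -/

section CStarCones

variable {𝔄 : Type u} [CStarAlgebra 𝔄]

theorem nonneg_iff_exists_star_mul_self {B : Type*} [CStarAlgebra B] [PartialOrder B]
    [StarOrderedRing B] (x : B) : 0 ≤ x ↔ ∃ y, x = star y * y :=
  CStarAlgebra.nonneg_iff_eq_star_mul_self

theorem algebraMap_real_mono (B : Type*) [CStarAlgebra B] [PartialOrder B]
    [StarOrderedRing B] {r s : ℝ} (h : r ≤ s) : algebraMap ℝ B r ≤ algebraMap ℝ B s :=
  algebraMap_mono B h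

theorem mem_cstarCones_iff [PartialOrder 𝔄] [StarOrderedRing 𝔄] {n : ℕ}
    (X : Matrix (Fin n) (Fin n) 𝔄) :
    X ∈ cstarCones 𝔄 n ↔ 0 ≤ CStarMatrix.ofMatrix X :=
  (nonneg_iff_exists_star_mul_self (CStarMatrix.ofMatrix X)).symm

theorem cstarCones_hermitian {n : ℕ} {X : Matrix (Fin n) (Fin n) 𝔄} (hX : X ∈ cstarCones 𝔄 n) :
    X.conjTranspose = X := by
  obtain ⟨Y, rfl⟩ := hX
  exact Matrix.isHermitian_conjTranspose_mul_self Y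

theorem zero_mem_cstarCones (n : ℕ) : (0 : Matrix (Fin n) (Fin n) 𝔄) ∈ cstarCones 𝔄 n :=
  ⟨0, by simp⟩

theorem add_mem_cstarCones {n : ℕ} {X Y : Matrix (Fin n) (Fin n) 𝔄}
    (hX : X ∈ cstarCones 𝔄 n) (hY : Y ∈ cstarCones 𝔄 n) : X + Y ∈ cstarCones 𝔄 n := by
  let := CStarAlgebra.spectralOrder 𝔄
  have := CStarAlgebra.spectralOrderedRing 𝔄
  rw [mem_cstarCones_iff] at *
  exact add_nonneg hX hY

theorem sum_mem_cstarCones {ι : Type*} {n : ℕ} (s : Finset ι)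
    (X : ι → Matrix (Fin n) (Fin n) 𝔄) (hX : ∀ i ∈ s, X i ∈ cstarCones 𝔄 n) :
    ∑ i ∈ s, X i ∈ cstarCones 𝔄 n :=
  Finset.sum_induction _ (· ∈ cstarCones 𝔄 n) (fun _ _ => add_mem_cstarCones)
    (zero_mem_cstarCones n) hX

/-- `W⋆ W` is positive also for rectangular `W`. -/
theorem conjTranspose_mul_self_mem_cstarCones {ι : Type*} [Fintype ι] {n : ℕ}
    (W : Matrix ι (Fin n) 𝔄) : W.conjTranspose * W ∈ cstarCones 𝔄 n := by
  rcases n with _ | n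
  · exact ⟨0, Subsingleton.elim _ _⟩
  have h : W.conjTranspose * W = ∑ k, Matrix.of fun i j => star (W k i) * W k j := by
    ext i j
    rw [Matrix.sum_apply, Matrix.mul_apply]
    rfl
  rw [h]
  -- Each row of `W` contributes one square: row `k` is placed as row `0` of an otherwise zero
  -- square matrix. Size zero has no row `0`, hence the case split above.
  refine sum_mem_cstarCones _ _ fun k _ => ⟨Matrix.of fun i j => if i = 0 then W k j else 0, ?_⟩
  ext i j
  simp [Matrix.mul_apply]

theorem conj_mem_cstarCones {n m : ℕ} {X : Matrix (Fin n) (Fin n) 𝔄} (hX : X ∈ cstarCones 𝔄 n)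
    (W : Matrix (Fin n) (Fin m) 𝔄) : W.conjTranspose * X * W ∈ cstarCones 𝔄 m := by
  obtain ⟨Y, rfl⟩ := hX
  have h := conjTranspose_mul_self_mem_cstarCones (Y * W)
  rwa [Matrix.conjTranspose_mul, Matrix.mul_assoc, ← Matrix.mul_assoc _ Y W,
    ← Matrix.mul_assoc] at h

theorem compression_eq_conj {n m : ℕ} (A : Matrix (Fin n) (Fin m) ℂ)
    (X : Matrix (Fin n) (Fin n) 𝔄) :
    compression A X = (A.map (algebraMap ℂ 𝔄)).conjTranspose * X * A.map (algebraMap ℂ 𝔄) := by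
  ext i j
  simp only [compression, Matrix.mul_apply, Matrix.conjTranspose_apply, Matrix.map_apply,
    Finset.sum_mul]
  rw [Finset.sum_comm]
  refine Finset.sum_congr rfl fun l _ => Finset.sum_congr rfl fun k _ => ?_
  rw [← algebraMap_star_comm, mul_assoc, ← Algebra.commutes, ← mul_assoc, ← map_mul,
    Algebra.smul_def]

theorem ofMatrix_smul_ampUnit [PartialOrder 𝔄] [StarOrderedRing 𝔄] (r : ℝ) (n : ℕ) :
    CStarMatrix.ofMatrix ((r : ℂ) • ampUnit (1 : 𝔄) n) =
      algebraMap ℝ (CStarMatrix (Fin n) (Fin n) 𝔄) r := by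
  rw [Algebra.algebraMap_eq_smul_one]
  ext i j
  by_cases h : i = j
  · subst h; simp [ampUnit]
  · simp [ampUnit, h]

theorem smul_ampUnit_sub_mem_cstarCones_iff [PartialOrder 𝔄] [StarOrderedRing 𝔄] (r : ℝ) {n : ℕ}
    (X : Matrix (Fin n) (Fin n) 𝔄) : (r : ℂ) • ampUnit 1 n - X ∈ cstarCones 𝔄 n ↔
      CStarMatrix.ofMatrix X ≤ algebraMap ℝ (CStarMatrix (Fin n) (Fin n) 𝔄) r := by
  rw [mem_cstarCones_iff, ← ofMatrix_smul_ampUnit]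
  exact sub_nonneg (a := CStarMatrix.ofMatrix ((r : ℂ) • ampUnit (1 : 𝔄) n))

theorem smul_mem_cstarCones {n : ℕ} {r : ℝ} (hr : 0 ≤ r) {X : Matrix (Fin n) (Fin n) 𝔄}
    (hX : X ∈ cstarCones 𝔄 n) : (r : ℂ) • X ∈ cstarCones 𝔄 n := by
  obtain ⟨Y, rfl⟩ := hX
  refine ⟨((√r : ℝ) : ℂ) • Y, ?_⟩
  rw [Matrix.conjTranspose_smul, Matrix.smul_mul, Matrix.mul_smul, smul_smul]
  congr 1
  simp [← Complex.ofReal_mul, Real.mul_self_sqrt hr]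

theorem isMatrixOrdered_cstarCones : IsMatrixOrdered (cstarCones 𝔄) where
  hermitian _ _ hX := cstarCones_hermitian hX
  zero_mem := zero_mem_cstarCones
  add_mem _ _ hX _ hY := add_mem_cstarCones hX hY
  smul_mem _ _ hr _ hX := smul_mem_cstarCones hr hX
  proper n X hX hX' := by
    let := CStarAlgebra.spectralOrder 𝔄
    have := CStarAlgebra.spectralOrderedRing 𝔄
    rw [mem_cstarCones_iff] at *
    have h : 0 ≤ -CStarMatrix.ofMatrix X := hX'
    exact (le_antisymm hX (neg_nonneg.1 h)).symm
  compression_mem n m A X hX := by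
    rw [compression_eq_conj]
    exact conj_mem_cstarCones hX _

/-- The order unit property is `X ≤ ‖X‖` for self-adjoint `X`, with `1` added to make the constant
strictly positive; the Archimedean property is closedness of the positive cone. -/
theorem isArchimedeanMatrixOrderUnit_cstarCones :
    IsArchimedeanMatrixOrderUnit (cstarCones 𝔄) (1 : 𝔄) := by
  let := CStarAlgebra.spectralOrder 𝔄
  have := CStarAlgebra.spectralOrderedRing 𝔄
  refine ⟨⟨star_one _, fun n X hX => ?_⟩, fun n X hX h => ?_⟩
  · refine ⟨‖CStarMatrix.ofMatrix X‖ + 1, by positivity, ?_⟩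
    have h : IsSelfAdjoint (CStarMatrix.ofMatrix X) := hX
    rw [smul_ampUnit_sub_mem_cstarCones_iff]
    refine h.le_algebraMap_norm_self.trans ?_
    exact algebraMap_real_mono _ (by linarith)
  · rw [mem_cstarCones_iff]
    have hc : Filter.Tendsto
        (fun r : ℝ => algebraMap ℝ (CStarMatrix (Fin n) (Fin n) 𝔄) r + CStarMatrix.ofMatrix X)
        (nhdsWithin 0 (Set.Ioi 0)) (nhds (CStarMatrix.ofMatrix X)) := by
      have : Continuous fun r : ℝ =>
          algebraMap ℝ (CStarMatrix (Fin n) (Fin n) 𝔄) r + CStarMatrix.ofMatrix X :=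
        (continuous_algebraMap _ _).add continuous_const
      have h0 := this.tendsto 0
      rw [map_zero, zero_add] at h0
      exact h0.mono_left nhdsWithin_le_nhds
    refine CStarAlgebra.isClosed_nonneg.mem_of_tendsto hc ?_
    filter_upwards [self_mem_nhdsWithin] with r hr
    have h1 := h r hr
    rw [mem_cstarCones_iff] at h1
    rw [← ofMatrix_smul_ampUnit]
    exact h1

/-- The `2 × 2` block matrix with rows `(r e, X)` and `(X⋆, r e)`. -/
def normBlock {V : Type u} [AddCommGroup V] [Module ℂ V] [StarAddMonoid V] (e : V) {n : ℕ}
    (X : Matrix (Fin n) (Fin n) V) (r : ℝ) : Matrix (Fin (n + n)) (Fin (n + n)) V :=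
  Matrix.reindex finSumFinEquiv finSumFinEquiv
    (Matrix.fromBlocks ((r : ℂ) • ampUnit e n) X X.conjTranspose ((r : ℂ) • ampUnit e n))

theorem smul_ampUnit_one (r : ℝ) (n : ℕ) :
    (r : ℂ) • ampUnit (1 : 𝔄) n = (r : ℂ) • (1 : Matrix (Fin n) (Fin n) 𝔄) := rfl

/-- Completing the square: since `T⋆T ≤ r²`, one can write `r - r⁻¹ T⋆T = Z⋆Z`. The block matrix is
then `W₁⋆W₁ + W₂⋆W₂` for the block rows `W₁ = (√r, T/√r)` and `W₂ = (0, Z)`. -/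
theorem normBlock_mem_cstarCones_of_norm_le [PartialOrder 𝔄] [StarOrderedRing 𝔄] {n : ℕ}
    {T : Matrix (Fin n) (Fin n) 𝔄} {r : ℝ} (hr : 0 < r) (hT : ‖CStarMatrix.ofMatrix T‖ ≤ r) :
    normBlock 1 T r ∈ cstarCones 𝔄 (n + n) := by
  have h1 : (r : ℂ) • (1 : Matrix (Fin n) (Fin n) 𝔄) - (r : ℂ)⁻¹ • (T.conjTranspose * T) ∈
      cstarCones 𝔄 n := by
    have h2 : CStarMatrix.ofMatrix (T.conjTranspose * T) ≤
        algebraMap ℝ (CStarMatrix (Fin n) (Fin n) 𝔄) (r ^ 2) := by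
      refine (CStarAlgebra.star_mul_le_algebraMap_norm_sq
        (a := CStarMatrix.ofMatrix T)).trans (algebraMap_real_mono _ ?_)
      exact pow_le_pow_left₀ (norm_nonneg _) hT 2
    have h3 := smul_mem_cstarCones (inv_nonneg.2 hr.le)
      ((smul_ampUnit_sub_mem_cstarCones_iff _ _).2 h2)
    have hr' : (r : ℂ) ≠ 0 := by exact_mod_cast hr.ne'
    rwa [smul_sub, smul_ampUnit_one, smul_smul, Complex.ofReal_inv, Complex.ofReal_pow, sq,
      inv_mul_cancel_left₀ hr'] at h3
  obtain ⟨Z, hZ⟩ := h1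
  have hs : ((√r : ℝ) : ℂ) * ((√r : ℝ) : ℂ) = r := by
    rw [← Complex.ofReal_mul, Real.mul_self_sqrt hr.le]
  have hs0 : ((√r : ℝ) : ℂ) ≠ 0 := by
    exact_mod_cast (Real.sqrt_pos.2 hr).ne'
  let W₁ : Matrix (Fin n) (Fin n ⊕ Fin n) 𝔄 :=
    Matrix.fromCols (((√r : ℝ) : ℂ) • 1) (((√r : ℝ) : ℂ)⁻¹ • T)
  let W₂ : Matrix (Fin n) (Fin n ⊕ Fin n) 𝔄 := Matrix.fromCols 0 Z
  have key : Matrix.fromBlocks ((r : ℂ) • ampUnit (1 : 𝔄) n) T T.conjTranspose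
      ((r : ℂ) • ampUnit (1 : 𝔄) n) = W₁.conjTranspose * W₁ + W₂.conjTranspose * W₂ := by
    simp only [W₁, W₂, Matrix.conjTranspose_fromCols_eq_fromRows_conjTranspose,
      Matrix.fromRows_mul_fromCols, Matrix.fromBlocks_add, Matrix.conjTranspose_smul,
      Matrix.smul_mul, Matrix.mul_smul, smul_smul, Matrix.conjTranspose_one,
      Matrix.conjTranspose_zero, Matrix.zero_mul, Matrix.mul_zero, add_zero, one_mul, mul_one,
      smul_ampUnit_one]
    rw [← hZ]
    congr 1
    · simp [hs]
    · simp [hs0]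
    · simp [hs0]
    · simp [← mul_inv, hs]
  rw [normBlock, key, Matrix.reindex_apply, Matrix.submatrix_add]
  exact add_mem_cstarCones
    (conjTranspose_mul_self_mem_cstarCones (W₁.submatrix id finSumFinEquiv.symm))
    (conjTranspose_mul_self_mem_cstarCones (W₂.submatrix id finSumFinEquiv.symm))

theorem norm_le_of_normBlock_mem_cstarCones [PartialOrder 𝔄] [StarOrderedRing 𝔄] {n : ℕ}
    {T : Matrix (Fin n) (Fin n) 𝔄} {r : ℝ} (hr : 0 < r)
    (h : normBlock 1 T r ∈ cstarCones 𝔄 (n + n)) : ‖CStarMatrix.ofMatrix T‖ ≤ r := by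
  -- This column is chosen so that conjugating the block matrix by it leaves `r (r² - T⋆T)`, up to a
  -- positive factor the Schur complement.
  let W : Matrix (Fin n ⊕ Fin n) (Fin n) 𝔄 := Matrix.fromRows (-T) ((r : ℂ) • 1)
  have h1 := conj_mem_cstarCones h (W.submatrix finSumFinEquiv.symm id)
  have h2 : (W.submatrix finSumFinEquiv.symm id).conjTranspose * normBlock 1 T r *
      (W.submatrix finSumFinEquiv.symm id) =
      (r : ℂ) • ((r ^ 2 : ℂ) • 1 - T.conjTranspose * T) := by
    rw [normBlock, Matrix.reindex_apply, Matrix.conjTranspose_submatrix,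
      Matrix.submatrix_mul_equiv, Matrix.submatrix_mul_equiv, Matrix.submatrix_id_id]
    simp only [W, Matrix.conjTranspose_fromRows_eq_fromCols_conjTranspose,
      Matrix.fromCols_mul_fromBlocks, Matrix.fromCols_mul_fromRows, smul_ampUnit_one,
      Matrix.conjTranspose_smul, Matrix.conjTranspose_neg, Matrix.smul_mul, Matrix.mul_smul,
      Matrix.conjTranspose_one, Matrix.mul_one, Matrix.one_mul, Matrix.neg_mul, Matrix.mul_neg,
      smul_smul, Matrix.add_mul, smul_sub, smul_add, smul_neg, Complex.star_def,
      Complex.conj_ofReal]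
    have : (r : ℂ) * (r : ℂ) ^ 2 = r * (r * r) := by ring
    rw [this]
    abel
  rw [h2] at h1
  have h3 := smul_mem_cstarCones (inv_nonneg.2 hr.le) h1
  have hr' : (r : ℂ) ≠ 0 := by exact_mod_cast hr.ne'
  rw [smul_smul, Complex.ofReal_inv, inv_mul_cancel₀ hr', one_smul] at h3
  have h4 : star (CStarMatrix.ofMatrix T) * CStarMatrix.ofMatrix T ≤
      algebraMap ℝ (CStarMatrix (Fin n) (Fin n) 𝔄) (r ^ 2) := by
    refine (smul_ampUnit_sub_mem_cstarCones_iff (r ^ 2) (T.conjTranspose * T)).1 ?_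
    rwa [smul_ampUnit_one, Complex.ofReal_pow]
  have h5 := (CStarAlgebra.norm_le_iff_le_algebraMap _ (sq_nonneg r)
    (star_mul_self_nonneg _)).2 h4
  rw [CStarRing.norm_star_mul_self, ← sq] at h5
  exact le_of_sq_le_sq h5 hr.le

theorem norm_ofMatrix_one_by_one [PartialOrder 𝔄] [StarOrderedRing 𝔄] (a : 𝔄) :
    ‖CStarMatrix.ofMatrix (Matrix.of fun _ _ : Fin 1 => a)‖ = ‖a‖ :=
  le_antisymm
    (NonUnitalStarAlgHom.norm_apply_le
      (CStarMatrix.toOneByOne (Fin 1) ℂ 𝔄).toNonUnitalStarAlgHom a)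
    (CStarMatrix.norm_entry_le_norm
      (M := CStarMatrix.ofMatrix (Matrix.of fun _ _ : Fin 1 => a)) (i := 0) (j := 0))

end CStarCones

/-! ### Separation of a hermitian matrix from a cone by a positive functional. -/

section Separation

theorem conjTranspose_ampUnit {V : Type u} [AddCommGroup V] [StarAddMonoid V] {e : V}
    (he : star e = e) (n : ℕ) : (ampUnit e n).conjTranspose = ampUnit e n := by
  rw [ampUnit, Matrix.diagonal_conjTranspose]
  congr 1
  exact funext fun _ => he

variable {V : Type u} [AddCommGroup V] [Module ℂ V] [StarAddMonoid V] [StarModule ℂ V]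
  {C : MatrixCones V} {e : V}

theorem ampUnit_mem (hC : IsMatrixOrdered C) (he : IsMatrixOrderUnit C e) (n : ℕ) :
    ampUnit e n ∈ C n := by
  obtain ⟨r, hr, h⟩ := he.2 n 0 (by simp)
  have h' := hC.smul_mem n r⁻¹ (inv_nonneg.2 hr.le) _ h
  have hr' : (r : ℂ) ≠ 0 := by exact_mod_cast hr.ne'
  rwa [sub_zero, smul_smul, Complex.ofReal_inv, inv_mul_cancel₀ hr', one_smul] at h'

/-- Hahn–Banach separation of a hermitian matrix from the cone of an abstract operator system. -/
theorem exists_positive_functional (hC : IsMatrixOrdered C)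
    (he : IsArchimedeanMatrixOrderUnit C e) {n : ℕ} {X : Matrix (Fin n) (Fin n) V}
    (hX : X.conjTranspose = X) (hXn : X ∉ C n) :
    ∃ s : Matrix (Fin n) (Fin n) V →ₗ[ℂ] ℂ, (∀ Y ∈ C n, 0 ≤ s Y) ∧ ¬ 0 ≤ s X := by
  have hE := conjTranspose_ampUnit he.1.1 n
  have hEC := ampUnit_mem hC he.1 n
  set E := ampUnit e n with hEdef
  -- The Archimedean property leaves room `r`: separating `Z = rE + X` only weakly, with value `1`
  -- at `E`, makes the value at `X` at most `-r`, hence strictly negative.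
  obtain ⟨r, hr, hZ⟩ : ∃ r : ℝ, 0 < r ∧ (r : ℂ) • E + X ∉ C n := by
    by_contra! h
    exact hXn (he.2 n X hX h)
  set Z := (r : ℂ) • E + X with hZdef
  have hZh : Z.conjTranspose = Z := by
    rw [hZdef, Matrix.conjTranspose_add, Matrix.conjTranspose_smul, hE, hX, Complex.star_def,
      Complex.conj_ofReal]
  have hE0 : E ≠ 0 := by
    intro h0
    obtain ⟨t, -, ht⟩ := he.1.2 n (-X) (by rw [Matrix.conjTranspose_neg, hX])
    rw [← hEdef, h0, smul_zero, sub_neg_eq_add, zero_add] at ht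
    exact hXn ht
  -- `P` consists of the `Y` with `Y + Y⋆ ∈ C n - ℝ₊ Z`. Using `Y + Y⋆` extends the cone to
  -- non-hermitian matrices, and any functional nonnegative on `P` is nonpositive at `Z`.
  let P : PointedCone ℝ (Matrix (Fin n) (Fin n) V) :=
    { carrier := {Y | ∃ u : ℝ, 0 ≤ u ∧ (Y + Y.conjTranspose) + (u : ℂ) • Z ∈ C n}
      zero_mem' := ⟨0, le_rfl, by simpa using hC.zero_mem n⟩
      add_mem' := by
        rintro Y Y' ⟨u, hu, h⟩ ⟨u', hu', h'⟩
        refine ⟨u + u', add_nonneg hu hu', ?_⟩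
        convert hC.add_mem n _ h _ h' using 1
        rw [Matrix.conjTranspose_add, Complex.ofReal_add, add_smul]
        abel
      smul_mem' := by
        rintro ⟨c, hc⟩ Y ⟨u, hu, h⟩
        refine ⟨c * u, mul_nonneg hc hu, ?_⟩
        convert hC.smul_mem n c hc _ h using 1
        change ((c : ℂ) • Y + ((c : ℂ) • Y).conjTranspose) + _ = _
        rw [Matrix.conjTranspose_smul, Complex.star_def, Complex.conj_ofReal,
          smul_add (c : ℂ), smul_add (c : ℂ),
          Complex.ofReal_mul, mul_smul] }
  have hP : ∀ Y, Y ∈ P ↔ ∃ u : ℝ, 0 ≤ u ∧ (Y + Y.conjTranspose) + (u : ℂ) • Z ∈ C n :=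
    fun Y => Iff.rfl
  have htE : ∀ t : ℝ, (t • E) + (t • E).conjTranspose = ((2 * t : ℝ) : ℂ) • E := by
    intro t
    change (t : ℂ) • E + ((t : ℂ) • E).conjTranspose = _
    rw [Matrix.conjTranspose_smul, Complex.star_def, Complex.conj_ofReal, hE, ← add_smul]
    congr 1
    push_cast; ring
  -- The functional `tE ↦ t` is extended from `ℝE`. It is nonnegative on `P ∩ ℝE`: for `t < 0`, `2tE
  -- + uZ ∈ C n` would give `Z ∈ C n` if `u > 0`, and `-E ∈ C n` if `u = 0`. The order unit supplies
  -- the cofinality that the extension needs.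
  obtain ⟨g, hg1, hg2⟩ := riesz_extension P (LinearPMap.mkSpanSingleton E (1 : ℝ) hE0)
    (by
      rintro ⟨x, hx⟩ hxP
      obtain ⟨t, rfl⟩ := Submodule.mem_span_singleton.1 hx
      have : (LinearPMap.mkSpanSingleton E (1 : ℝ) hE0 : _ →ₗ.[ℝ] ℝ) ⟨t • E, hx⟩ = t := by
        exact (LinearPMap.mkSpanSingleton'_apply E (1 : ℝ) _ t hx).trans (mul_one t)
      rw [this]
      by_contra! ht
      obtain ⟨u, hu, h⟩ := (hP _).1 hxP
      rw [htE] at h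
      have h1 := hC.add_mem n _ h _ (hC.smul_mem n (-(2 * t)) (by linarith) _ hEC)
      rw [add_right_comm, ← add_smul, ← Complex.ofReal_add, add_neg_cancel, Complex.ofReal_zero,
        zero_smul, zero_add] at h1
      rcases hu.eq_or_lt with rfl | hu
      · rw [Complex.ofReal_zero, zero_smul, add_zero] at h
        have h2 := hC.smul_mem n (-(2 * t))⁻¹ (inv_nonneg.2 (by linarith)) _ h
        have h3 : -(2 * t) ≠ 0 := by linarith
        rw [smul_smul, ← Complex.ofReal_mul, inv_neg, neg_mul, inv_mul_cancel₀ (by linarith),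
          Complex.ofReal_neg, Complex.ofReal_one, neg_one_smul] at h2
        exact hE0 (hC.proper n E hEC h2)
      · have h2 := hC.smul_mem n u⁻¹ (inv_nonneg.2 hu.le) _ h1
        rw [smul_smul, ← Complex.ofReal_mul, inv_mul_cancel₀ hu.ne', Complex.ofReal_one,
          one_smul] at h2
        exact hZ h2)
    (by
      intro Y
      obtain ⟨t, -, ht⟩ := he.1.2 n (-(Y + Y.conjTranspose)) (by
        rw [Matrix.conjTranspose_neg, Matrix.conjTranspose_add, Matrix.conjTranspose_conjTranspose,
          add_comm])
      refine ⟨⟨(t / 2) • E, Submodule.smul_mem _ _ (Submodule.mem_span_singleton_self E)⟩,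
        (hP _).2 ⟨0, le_rfl, ?_⟩⟩
      rw [sub_neg_eq_add] at ht
      convert ht using 1
      have h := htE (t / 2)
      rw [mul_div_cancel₀ _ two_ne_zero] at h
      rw [← h, Matrix.conjTranspose_add, Complex.ofReal_zero, zero_smul]
      abel)
  have hgE : g E = 1 := by
    have h := hg1 ⟨E, Submodule.mem_span_singleton_self E⟩
    rw [h]
    exact LinearPMap.mkSpanSingleton'_apply_self E (1 : ℝ) _ _
  have hgC : ∀ Y ∈ C n, 0 ≤ g Y := fun Y hY => hg2 Y ((hP Y).2 ⟨0, le_rfl, by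
    rw [hC.hermitian n Y hY, Complex.ofReal_zero, zero_smul, add_zero]
    exact hC.add_mem n _ hY _ hY⟩)
  have hgI : ∀ Y : Matrix (Fin n) (Fin n) V, Y.conjTranspose = Y → g (Complex.I • Y) = 0 := by
    intro Y hY
    have h1 : (Complex.I • Y) + (Complex.I • Y).conjTranspose = 0 := by
      rw [Matrix.conjTranspose_smul, hY, Complex.star_def, Complex.conj_I, neg_smul,
        add_neg_cancel]
    have h2 := hg2 (Complex.I • Y) ((hP _).2 ⟨0, le_rfl, by
      rw [h1]; simpa using hC.zero_mem n⟩)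
    have h3 := hg2 (-(Complex.I • Y)) ((hP _).2 ⟨0, le_rfl, by
      rw [Matrix.conjTranspose_neg, ← neg_add, h1]; simpa using hC.zero_mem n⟩)
    rw [map_neg] at h3
    linarith
  have hgZ : g Z ≤ 0 := by
    have h := hg2 (-Z) ((hP _).2 ⟨2, by norm_num, by
      rw [Matrix.conjTranspose_neg, hZh, Complex.ofReal_ofNat, two_smul]
      simpa using hC.zero_mem n⟩)
    rw [map_neg] at h
    linarith
  have hgX : g X < 0 := by
    have h : g Z = r * 1 + g X := by
      rw [← hgE, hZdef, map_add]
      congr 1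
      exact g.map_smul r E
    linarith
  -- The complexification is `Y ↦ g Y - i g(iY)`; it agrees with `g` on hermitian `Y` because `g(iY)
  -- = 0` there.
  refine ⟨Module.Dual.extendRCLike (𝕜 := ℂ) g, fun Y hY => ?_, fun h => ?_⟩
  · rw [Module.Dual.extendRCLike_apply, RCLike.I_to_complex, hgI Y (hC.hermitian n Y hY)]
    simpa using hgC Y hY
  · rw [Module.Dual.extendRCLike_apply, RCLike.I_to_complex, hgI X hX] at h
    simp at h
    linarith

end Separation

/-! ### Hilbert spaces and bounded operators obtained from sesquilinear forms. -/

section Dense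

variable {F : Type*} {H : Type*} [NormedAddCommGroup H] [InnerProductSpace ℂ H]


theorem eq_of_inner_denseRange {ι : F → H} (hι : DenseRange ι) {x y : H}
    (h : ∀ w, ⟪x, ι w⟫_ℂ = ⟪y, ι w⟫_ℂ) : x = y := by
  refine ext_inner_right ℂ fun v => ?_
  exact hι.induction_on v (isClosed_eq (by fun_prop) (by fun_prop)) h

theorem clm_eq_of_inner_denseRange {ι : F → H} (hι : DenseRange ι) {T T' : H →L[ℂ] H}
    (h : ∀ v w, ⟪ι v, T (ι w)⟫_ℂ = ⟪ι v, T' (ι w)⟫_ℂ) : T = T' := by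
  refine ContinuousLinearMap.ext fun x => ?_
  refine hι.induction_on x (isClosed_eq (by fun_prop) (by fun_prop)) fun w => ?_
  refine eq_of_inner_denseRange hι fun v => ?_
  rw [← inner_conj_symm, h, inner_conj_symm]

end Dense

section Forms

variable {F : Type u} [AddCommGroup F] [Module ℂ F]
  {H : Type*} [NormedAddCommGroup H] [InnerProductSpace ℂ H]

/-- Polarization: the diagonal values at `v + w` and `v + iw` compare the imaginary and the real
parts of `S v w` and `S w v`. -/
theorem conj_form_of_im_diag_eq_zero (S : F →ₗ⋆[ℂ] F →ₗ[ℂ] ℂ) (h : ∀ v, (S v v).im = 0)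
    (v w : F) : (starRingEnd ℂ) (S v w) = S w v := by
  have h1 := h (v + w)
  have h2 := h (v + Complex.I • w)
  have hv := h v
  have hw := h w
  simp at h1 h2
  apply Complex.ext
  · simp; linarith
  · simp; linarith

theorem exists_hilbert_of_form (S : F →ₗ⋆[ℂ] F →ₗ[ℂ] ℂ) (h : ∀ v, 0 ≤ S v v) :
    ∃ (H : Type u) (_ : NormedAddCommGroup H) (_ : InnerProductSpace ℂ H) (_ : CompleteSpace H)
      (ι : F →ₗ[ℂ] H), DenseRange ι ∧ ∀ v w, ⟪ι v, ι w⟫_ℂ = S v w := by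
  let core : PreInnerProductSpace.Core ℂ F :=
    { inner := fun v w => S v w
      conj_inner_symm := fun v w =>
        conj_form_of_im_diag_eq_zero S (fun v => (Complex.nonneg_iff.1 (h v)).2.symm) w v
      re_inner_nonneg := fun v => (Complex.nonneg_iff.1 (h v)).1
      add_left := fun v v' w => by simp
      smul_left := fun v w r => by simp }
  let : SeminormedAddCommGroup F := InnerProductSpace.Core.toSeminormedAddCommGroup (c := core)
  let : InnerProductSpace ℂ F := InnerProductSpace.ofCore core
  exact ⟨UniformSpace.Completion F, inferInstance, inferInstance, inferInstance,
    { toFun := fun v => (v : UniformSpace.Completion F)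
      map_add' := UniformSpace.Completion.coe_add
      map_smul' := UniformSpace.Completion.coe_smul },
    UniformSpace.Completion.denseRange_coe, fun v w => UniformSpace.Completion.inner_coe v w⟩

/-- For fixed `v` the functional `B v` factors through `ι` and extends to `H`, so it is represented
by a vector `u v`. The bound makes `ι v ↦ u v` a bounded operator, and since `u v` stands in the
left slot, `T` is its adjoint. -/
theorem exists_clm_of_form [CompleteSpace H] {ι : F →ₗ[ℂ] H} (hι : DenseRange ι)
    (B : F →ₗ⋆[ℂ] F →ₗ[ℂ] ℂ) {c : ℝ} (hB : ∀ v w, ‖B v w‖ ≤ c * ‖ι v‖ * ‖ι w‖) :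
    ∃ T : H →L[ℂ] H, ∀ v w, ⟪ι v, T (ι w)⟫_ℂ = B v w := by
  have hB' : ∀ v w, ‖B v w‖ ≤ (|c| * ‖ι v‖) * ‖ι w‖ := fun v w =>
    (hB v w).trans (by gcongr; exact le_abs_self c)
  have hu : ∀ v, ∃ x : H, (∀ w, ⟪x, ι w⟫_ℂ = B v w) ∧ ‖x‖ ≤ |c| * ‖ι v‖ := by
    intro v
    refine ⟨(InnerProductSpace.toDual ℂ H).symm ((B v).extendOfNorm ι), fun w => ?_, ?_⟩
    · rw [InnerProductSpace.toDual_symm_apply]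
      exact LinearMap.extendOfNorm_eq hι ⟨_, hB' v⟩ w
    · rw [LinearIsometryEquiv.norm_map]
      exact LinearMap.opNorm_extendOfNorm_le hι (by positivity) (hB' v)
  choose u hu1 hu2 using hu
  let U : F →ₗ[ℂ] H :=
    { toFun := u
      map_add' := fun v v' => eq_of_inner_denseRange hι fun w => by
        rw [inner_add_left, hu1, hu1, hu1]; simp
      map_smul' := fun a v => eq_of_inner_denseRange hι fun w => by
        rw [inner_smul_left, hu1, hu1]; simp }
  refine ⟨ContinuousLinearMap.adjoint (U.extendOfNorm ι), fun v w => ?_⟩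
  rw [ContinuousLinearMap.adjoint_inner_right, LinearMap.extendOfNorm_eq hι ⟨|c|, hu2⟩ v]
  exact hu1 v w

end Forms

/-! ### Positivity of operator matrices tested on columns of vectors. -/

section MatApply

variable {H : Type u} [NormedAddCommGroup H] [InnerProductSpace ℂ H]
  {n : ℕ}

/-- The action of a matrix of operators on a column of vectors. -/
def matApply (X : Matrix (Fin n) (Fin n) (H →L[ℂ] H)) (ξ : Fin n → H) : Fin n → H :=
  fun i => ∑ j, X i j (ξ j)

theorem matApply_mul (X Y : Matrix (Fin n) (Fin n) (H →L[ℂ] H)) (ξ : Fin n → H) :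
    matApply (X * Y) ξ = matApply X (matApply Y ξ) := by
  funext i
  simp only [matApply, Matrix.mul_apply, sum_apply, map_sum]
  rw [Finset.sum_comm]
  rfl

theorem matApply_neg (X : Matrix (Fin n) (Fin n) (H →L[ℂ] H)) (ξ : Fin n → H) :
    matApply (-X) ξ = -matApply X ξ := by
  funext i
  simp [matApply]

theorem eq_zero_of_matApply (X : Matrix (Fin n) (Fin n) (H →L[ℂ] H))
    (h : ∀ ξ, matApply X ξ = 0) : X = 0 := by
  ext i j x
  have h1 := congrFun (h (Pi.single j x)) i
  rw [matApply, Finset.sum_eq_single j] at h1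
  · simpa using h1
  · intro k _ hk
    simp [Pi.single_eq_of_ne hk]
  · simp

variable [CompleteSpace H]

theorem sum_inner_matApply_conjTranspose (X : Matrix (Fin n) (Fin n) (H →L[ℂ] H))
    (ξ η : Fin n → H) :
    ∑ i, ⟪ξ i, matApply X.conjTranspose η i⟫_ℂ = ∑ i, ⟪matApply X ξ i, η i⟫_ℂ := by
  simp only [matApply, inner_sum, sum_inner, Matrix.conjTranspose_apply,
    ContinuousLinearMap.star_eq_adjoint, ContinuousLinearMap.adjoint_inner_right]
  exact Finset.sum_comm

theorem sum_inner_nonneg_of_mem_cstarCones {X : Matrix (Fin n) (Fin n) (H →L[ℂ] H)}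
    (hX : X ∈ cstarCones (H →L[ℂ] H) n) (ξ : Fin n → H) :
    0 ≤ ∑ i, ⟪ξ i, matApply X ξ i⟫_ℂ := by
  obtain ⟨Y, rfl⟩ := hX
  rw [matApply_mul, sum_inner_matApply_conjTranspose]
  refine Finset.sum_nonneg fun i _ => ?_
  rw [inner_self_eq_norm_sq_to_K]
  positivity

theorem eq_zero_of_sum_inner_conjTranspose_mul_self {Y : Matrix (Fin n) (Fin n) (H →L[ℂ] H)}
    (h : ∀ ξ : Fin n → H, ∑ i, ⟪ξ i, matApply (Y.conjTranspose * Y) ξ i⟫_ℂ ≤ 0) : Y = 0 := by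
  refine eq_zero_of_matApply Y fun ξ => ?_
  have h1 := h ξ
  rw [matApply_mul, sum_inner_matApply_conjTranspose] at h1
  have h3 : ∀ i, 0 ≤ ⟪matApply Y ξ i, matApply Y ξ i⟫_ℂ := fun i => by
    rw [inner_self_eq_norm_sq_to_K]
    positivity
  have h2 := le_antisymm h1 (Finset.sum_nonneg fun i _ => h3 i)
  rw [Finset.sum_eq_zero_iff_of_nonneg fun i _ => h3 i] at h2
  funext i
  exact inner_self_eq_zero.1 (h2 i (Finset.mem_univ i))

/-- Take `N = M⁻`. As `M⁻ M⁺ = 0`, the compression `N M N` is `-(M⁻)³`, and the vanishing of this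
cube forces `M⁻ = 0`. -/
theorem negPart_cube {B : Type*} [CStarAlgebra B] [PartialOrder B] [StarOrderedRing B] {M : B}
    (hM : IsSelfAdjoint M) : ∃ N Z : B, star N = N ∧ N * M * N = -(star Z * Z) ∧
      (Z = 0 → 0 ≤ M) := by
  have h0 : 0 ≤ M⁻ := CFC.negPart_nonneg M
  have hs : star M⁻ = M⁻ := h0.isSelfAdjoint
  have h1 : 0 ≤ M⁻ * M⁻ * M⁻ := by
    have := star_left_conjugate_nonneg h0 M⁻
    rwa [hs] at this
  obtain ⟨Z, hZ⟩ := (nonneg_iff_exists_star_mul_self _).1 h1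
  refine ⟨M⁻, Z, hs, ?_, fun hZ0 => ?_⟩
  · rw [← hZ]
    nth_rewrite 2 [← CFC.posPart_sub_negPart M hM]
    rw [mul_sub, CFC.negPart_mul_posPart, zero_sub, neg_mul]
  · rw [hZ0, mul_zero] at hZ
    have h2 : M⁻ * M⁻ = 0 := by
      rw [← CStarRing.star_mul_self_eq_zero_iff, star_mul, hs, ← mul_assoc, hZ, zero_mul]
    have h3 : M⁻ = 0 := by
      rw [← CStarRing.star_mul_self_eq_zero_iff, hs, h2]
    exact (CFC.negPart_eq_zero_iff M hM).1 h3

/-- Testing the hypothesis on columns `N ξ`, with `N` the negative part of `X`, gives `-∑ ‖(Z ξ)ᵢ‖²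
≥ 0`. So `Z = 0` and `X` has no negative part. No identification of operator matrices with operators
on `Hⁿ` is needed. -/
theorem mem_cstarCones_of_sum_inner_nonneg {X : Matrix (Fin n) (Fin n) (H →L[ℂ] H)}
    (hX : X.conjTranspose = X) (h : ∀ ξ : Fin n → H, 0 ≤ ∑ i, ⟪ξ i, matApply X ξ i⟫_ℂ) :
    X ∈ cstarCones (H →L[ℂ] H) n := by
  obtain ⟨N, Z, hN, hNZ, hZ⟩ := negPart_cube (M := CStarMatrix.ofMatrix X) hX
  rw [mem_cstarCones_iff]
  apply hZ
  let N' : Matrix (Fin n) (Fin n) (H →L[ℂ] H) := CStarMatrix.ofMatrix.symm N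
  let Z' : Matrix (Fin n) (Fin n) (H →L[ℂ] H) := CStarMatrix.ofMatrix.symm Z
  have hN' : N'.conjTranspose = N' := hN
  have hNZ' : N' * X * N' = -(Z'.conjTranspose * Z') := hNZ
  refine eq_zero_of_sum_inner_conjTranspose_mul_self (Y := Z') fun ξ => ?_
  rw [← neg_neg (Z'.conjTranspose * Z'), ← hNZ', matApply_neg, Matrix.mul_assoc, matApply_mul,
    matApply_mul]
  have h1 := h (matApply N' ξ)
  have h2 := sum_inner_matApply_conjTranspose N' ξ (matApply X (matApply N' ξ))
  rw [hN'] at h2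
  rw [← h2] at h1
  simpa using h1

end MatApply

/-! ### The direct sum of the forms of all positive functionals. -/

section PositiveForm

theorem ampUnit_one_eq {V : Type u} [AddCommGroup V] (e : V) :
    ampUnit e 1 = Matrix.of fun _ _ => e := by
  ext i j
  rw [Subsingleton.elim i 0, Subsingleton.elim j 0]
  simp [ampUnit]

variable {V : Type u} [AddCommGroup V] [Module ℂ V] {C : MatrixCones V}

theorem compression_one {n : ℕ} (X : Matrix (Fin n) (Fin n) V) : compression 1 X = X := by
  ext i j
  simp [compression, Matrix.one_apply]

/-- The matrix `[conj vᵢ wⱼ b]`. -/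
def rankOneMatrix {n : ℕ} (b : V) (v w : Fin n → ℂ) : Matrix (Fin n) (Fin n) V :=
  Matrix.of fun i j => (star (v i) * w j) • b

/-- This identity turns stability of the cones under compression into complete positivity of the
forms. -/
theorem sum_rankOneMatrix {n m : ℕ} (X : Matrix (Fin m) (Fin m) V) (A : Fin m → Fin n → ℂ) :
    ∑ k, ∑ l, rankOneMatrix (X k l) (A k) (A l) = compression (Matrix.of A) X := by
  ext i j
  simp [Matrix.sum_apply, rankOneMatrix, compression]

theorem rankOneMatrix_add_left {n : ℕ} (b : V) (v v' w : Fin n → ℂ) :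
    rankOneMatrix b (v + v') w = rankOneMatrix b v w + rankOneMatrix b v' w := by
  ext i j
  simp [rankOneMatrix, add_mul, add_smul]

theorem rankOneMatrix_add_right {n : ℕ} (b : V) (v w w' : Fin n → ℂ) :
    rankOneMatrix b v (w + w') = rankOneMatrix b v w + rankOneMatrix b v w' := by
  ext i j
  simp [rankOneMatrix, mul_add, add_smul]

theorem rankOneMatrix_add {n : ℕ} (b b' : V) (v w : Fin n → ℂ) :
    rankOneMatrix (b + b') v w = rankOneMatrix b v w + rankOneMatrix b' v w := by
  ext i j
  simp [rankOneMatrix]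

theorem rankOneMatrix_smul_left {n : ℕ} (a : ℂ) (b : V) (v w : Fin n → ℂ) :
    rankOneMatrix b (a • v) w = star a • rankOneMatrix b v w := by
  ext i j
  simp [rankOneMatrix, smul_smul, mul_assoc]

theorem rankOneMatrix_smul_right {n : ℕ} (a : ℂ) (b : V) (v w : Fin n → ℂ) :
    rankOneMatrix b v (a • w) = a • rankOneMatrix b v w := by
  ext i j
  simp [rankOneMatrix, smul_smul, mul_left_comm]

theorem rankOneMatrix_smul {n : ℕ} (a : ℂ) (b : V) (v w : Fin n → ℂ) :
    rankOneMatrix (a • b) v w = a • rankOneMatrix b v w := by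
  ext i j
  simp [rankOneMatrix, smul_smul, mul_comm]

variable (C) in
/-- The positive functionals on all the matrix levels. -/
abbrev PositiveFunctionals : Type u :=
  Σ n : ℕ, {s : Matrix (Fin n) (Fin n) V →ₗ[ℂ] ℂ // ∀ Y ∈ C n, 0 ≤ s Y}

open Classical in
variable (C) in
/-- The direct sum of the forms `(v, w) ↦ s [conj vᵢ wⱼ b]` over all positive functionals `s`. -/
noncomputable def positiveForm (b : V) (v w : Π₀ p : PositiveFunctionals C, Fin p.1 → ℂ) : ℂ :=
  ∑ p ∈ v.support, p.2.1 (rankOneMatrix b (v p) (w p))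

open Classical in
theorem positiveForm_eq_sum (b : V) (v w : Π₀ p : PositiveFunctionals C, Fin p.1 → ℂ)
    {S : Finset (PositiveFunctionals C)} (hS : v.support ⊆ S) :
    positiveForm C b v w = ∑ p ∈ S, p.2.1 (rankOneMatrix b (v p) (w p)) := by
  refine Finset.sum_subset hS fun p _ hp => ?_
  have h : v p = 0 := by simpa using hp
  have h0 : rankOneMatrix b (v p) (w p) = 0 := by
    ext i j
    simp [rankOneMatrix, h]
  rw [h0, map_zero]

open Classical in
variable (C) in
/-- `positiveForm` as a linear family of sesquilinear forms. -/
noncomputable def positiveFormₗ : V →ₗ[ℂ] (Π₀ p : PositiveFunctionals C, Fin p.1 → ℂ) →ₗ⋆[ℂ]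
    (Π₀ p : PositiveFunctionals C, Fin p.1 → ℂ) →ₗ[ℂ] ℂ where
  toFun b := LinearMap.mk₂'ₛₗ (starRingEnd ℂ) (RingHom.id ℂ) (positiveForm C b)
    (fun v v' w => by
      rw [positiveForm_eq_sum b (v + v') w (S := (v + v').support ∪ (v.support ∪ v'.support))
          Finset.subset_union_left,
        positiveForm_eq_sum b v w (S := (v + v').support ∪ (v.support ∪ v'.support))
          (Finset.subset_union_left.trans Finset.subset_union_right),
        positiveForm_eq_sum b v' w (S := (v + v').support ∪ (v.support ∪ v'.support))
          (Finset.subset_union_right.trans Finset.subset_union_right), ← Finset.sum_add_distrib]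
      simp only [DFinsupp.add_apply, rankOneMatrix_add_left, map_add])
    (fun a v w => by
      rw [positiveForm_eq_sum b (a • v) w (DFinsupp.support_smul a v), positiveForm,
        Finset.smul_sum]
      simp only [DFinsupp.smul_apply, rankOneMatrix_smul_left, map_smul]
      rfl)
    (fun v w w' => by
      simp only [positiveForm, DFinsupp.add_apply, rankOneMatrix_add_right, map_add,
        Finset.sum_add_distrib])
    (fun a v w => by
      simp only [positiveForm, DFinsupp.smul_apply, rankOneMatrix_smul_right, map_smul,
        Finset.smul_sum, RingHom.id_apply])
  map_add' b b' := by
    refine LinearMap.ext fun v => LinearMap.ext fun w => ?_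
    change positiveForm C _ v w = positiveForm C b v w + positiveForm C b' v w
    simp only [positiveForm, rankOneMatrix_add,
      map_add, Finset.sum_add_distrib]
  map_smul' a b := by
    refine LinearMap.ext fun v => LinearMap.ext fun w => ?_
    change positiveForm C _ v w = a • positiveForm C b v w
    simp only [positiveForm, rankOneMatrix_smul, map_smul, Finset.smul_sum]

theorem positiveFormₗ_apply (b : V) (v w : Π₀ p : PositiveFunctionals C, Fin p.1 → ℂ) :
    positiveFormₗ C b v w = positiveForm C b v w := rfl

open Classical in
-- Standard basis vectors in the summand of `s` correspond to compression by the identity. Thus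
-- every value `s X` is visible in the Hilbert space representation.
theorem sum_positiveFormₗ_single {n : ℕ} (X : Matrix (Fin n) (Fin n) V)
    (s : {s : Matrix (Fin n) (Fin n) V →ₗ[ℂ] ℂ // ∀ Y ∈ C n, 0 ≤ s Y}) :
    ∑ i, ∑ j, positiveFormₗ C (X i j)
      (DFinsupp.single (⟨n, s⟩ : PositiveFunctionals C) (Pi.single i 1))
      (DFinsupp.single (⟨n, s⟩ : PositiveFunctionals C) (Pi.single j 1)) = s.1 X := by
  have h : ∀ i j, positiveFormₗ C (X i j)
      (DFinsupp.single (⟨n, s⟩ : PositiveFunctionals C) (Pi.single i 1))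
      (DFinsupp.single (⟨n, s⟩ : PositiveFunctionals C) (Pi.single j 1)) =
      s.1 (rankOneMatrix (X i j) (Pi.single i 1) (Pi.single j 1)) := by
    intro i j
    rw [positiveFormₗ_apply, positiveForm_eq_sum _ _ _ DFinsupp.support_single_subset,
      Finset.sum_singleton, DFinsupp.single_eq_same,
      DFinsupp.single_eq_same]
  simp only [h, ← map_sum]
  have h1 : (Matrix.of fun i : Fin n => (Pi.single i 1 : Fin n → ℂ)) = 1 := by
    ext i j
    simp [Matrix.one_apply, Pi.single_apply, eq_comm]
  rw [sum_rankOneMatrix X fun i => Pi.single i 1, h1, compression_one]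

end PositiveForm

/-! ### The Choi–Effros representation. -/

section Representation

variable {V : Type u} [AddCommGroup V] [Module ℂ V] [StarAddMonoid V] [StarModule ℂ V]
  {C : MatrixCones V} {e : V}

/-- The Hilbert space representation given by a completely positive family of sesquilinear
forms. -/
theorem exists_representation_of_forms (hC : IsMatrixOrdered C) (he : IsMatrixOrderUnit C e)
    {F : Type u} [AddCommGroup F] [Module ℂ F] (K : V →ₗ[ℂ] F →ₗ⋆[ℂ] F →ₗ[ℂ] ℂ)
    (hK : ∀ n, ∀ X ∈ C n, ∀ v : Fin n → F, 0 ≤ ∑ i, ∑ j, K (X i j) (v i) (v j)) :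
    ∃ (H : Type u) (_ : NormedAddCommGroup H) (_ : InnerProductSpace ℂ H) (_ : CompleteSpace H)
      (ι : F →ₗ[ℂ] H) (φ : V →ₗ[ℂ] (H →L[ℂ] H)),
      (∀ b v w, ⟪ι v, φ b (ι w)⟫_ℂ = K b v w) ∧ φ e = 1 ∧ (∀ b, φ (star b) = star (φ b)) ∧
      IsCompletelyPositive C (cstarCones (H →L[ℂ] H)) φ := by
  have hpos : ∀ b : V, Matrix.of (fun _ _ : Fin 1 => b) ∈ C 1 → ∀ v, 0 ≤ K b v v := by
    intro b hb v
    simpa using hK 1 _ hb fun _ => v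
  have heC : Matrix.of (fun _ _ : Fin 1 => e) ∈ C 1 := by
    rw [← ampUnit_one_eq]
    exact ampUnit_mem hC he 1
  have hunit : ∀ b : V, star b = b →
      ∃ r : ℝ, 0 < r ∧ Matrix.of (fun _ _ : Fin 1 => (r : ℂ) • e - b) ∈ C 1 := by
    intro b hb
    obtain ⟨r, hr, h⟩ := he.2 1 (Matrix.of fun _ _ => b) (by ext; simp [hb])
    rw [ampUnit_one_eq] at h
    exact ⟨r, hr, h⟩
  obtain ⟨H, _, _, _, ι, hι, hιK⟩ := exists_hilbert_of_form (K e) (hpos e heC)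
  -- forms of positive elements are bounded
  have hbddpos : ∀ b : V, Matrix.of (fun _ _ : Fin 1 => b) ∈ C 1 →
      ∃ c : ℝ, ∀ v w, ‖K b v w‖ ≤ c * ‖ι v‖ * ‖ι w‖ := by
    intro b hb
    have hbs : star b = b := congrFun (congrFun (hC.hermitian 1 _ hb) 0) 0
    obtain ⟨r, hr, h⟩ := hunit b hbs
    -- A second Hilbert space, built from `K b`, provides Cauchy–Schwarz for this form; `b ≤ r e`
    -- compares its norm with that of `ι`.
    obtain ⟨H', _, _, _, κ, -, hκK⟩ := exists_hilbert_of_form (K b) (hpos b hb)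
    have hle : ∀ v, ‖κ v‖ ≤ √r * ‖ι v‖ := by
      intro v
      have h1 := hpos _ h v
      simp only [map_sub, map_smul, LinearMap.sub_apply, LinearMap.smul_apply, ← hιK, ← hκK,
        inner_self_eq_norm_sq_to_K, smul_eq_mul] at h1
      have h2 : 0 ≤ r * ‖ι v‖ ^ 2 - ‖κ v‖ ^ 2 := by
        rw [← Complex.zero_le_real]
        simpa using h1
      refine le_of_sq_le_sq ?_ (by positivity)
      rw [mul_pow, Real.sq_sqrt hr.le]
      linarith
    refine ⟨√r * √r, fun v w => ?_⟩
    rw [← hκK]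
    calc ‖⟪κ v, κ w⟫_ℂ‖ ≤ ‖κ v‖ * ‖κ w‖ := norm_inner_le_norm _ _
      _ ≤ (√r * ‖ι v‖) * (√r * ‖ι w‖) := by gcongr <;> exact hle _
      _ = _ := by ring
  have hadd : ∀ (b b' : V) (a : ℂ), (∃ c : ℝ, ∀ v w, ‖K b v w‖ ≤ c * ‖ι v‖ * ‖ι w‖) →
      (∃ c : ℝ, ∀ v w, ‖K b' v w‖ ≤ c * ‖ι v‖ * ‖ι w‖) →
      ∃ c : ℝ, ∀ v w, ‖K (b + a • b') v w‖ ≤ c * ‖ι v‖ * ‖ι w‖ := by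
    rintro b b' a ⟨c, hc⟩ ⟨c', hc'⟩
    refine ⟨c + ‖a‖ * c', fun v w => ?_⟩
    simp only [map_add, map_smul, LinearMap.add_apply, LinearMap.smul_apply, smul_eq_mul]
    calc _ ≤ ‖K b v w‖ + ‖a * K b' v w‖ := norm_add_le _ _
      _ ≤ c * ‖ι v‖ * ‖ι w‖ + ‖a‖ * (c' * ‖ι v‖ * ‖ι w‖) := by
        rw [norm_mul]
        gcongr
        · exact hc v w
        · exact hc' v w
      _ = _ := by ring
  have hbddsa : ∀ b : V, star b = b → ∃ c : ℝ, ∀ v w, ‖K b v w‖ ≤ c * ‖ι v‖ * ‖ι w‖ := by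
    intro b hb
    obtain ⟨r, hr, h⟩ := hunit b hb
    -- A self-adjoint `b` is the difference `r e - (r e - b)` of positive elements.
    have h1 := hadd _ _ (-1 : ℂ) (hadd 0 e (r : ℂ) ⟨0, by simp⟩ (hbddpos e heC)) (hbddpos _ h)
    rwa [zero_add, neg_one_smul, ← sub_eq_add_neg, sub_sub_cancel] at h1
  have hdec : ∀ b : V, b = (realPart b : V) + Complex.I • (imaginaryPart b : V) := fun b =>
    (realPart_add_I_smul_imaginaryPart b).symm
  have hbdd : ∀ b : V, ∃ c : ℝ, ∀ v w, ‖K b v w‖ ≤ c * ‖ι v‖ * ‖ι w‖ := by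
    intro b
    rw [hdec b]
    exact hadd _ _ _ (hbddsa _ (realPart b).2) (hbddsa _ (imaginaryPart b).2)
  have hsym0 : ∀ b : V, star b = b → ∀ v w, (starRingEnd ℂ) (K b v w) = K b w v := by
    intro b hb v w
    refine conj_form_of_im_diag_eq_zero (K b) (fun v => ?_) v w
    obtain ⟨r, hr, h⟩ := hunit b hb
    have h1 := (Complex.nonneg_iff.1 (hpos _ h v)).2
    have h2 := (Complex.nonneg_iff.1 (hpos _ heC v)).2
    simp at h1
    rw [← h2] at h1
    simpa using h1
  have hsym : ∀ b v w, (starRingEnd ℂ) (K b v w) = K (star b) w v := by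
    intro b v w
    have h1 := hsym0 _ (realPart b).2 v w
    have h2 := hsym0 _ (imaginaryPart b).2 v w
    have h3 : star b = (realPart b : V) - Complex.I • (imaginaryPart b : V) := by
      nth_rewrite 1 [hdec b]
      rw [star_add, star_smul, show star (realPart b : V) = _ from (realPart b).2,
        show star (imaginaryPart b : V) = _ from (imaginaryPart b).2, Complex.star_def,
        Complex.conj_I, neg_smul, sub_eq_add_neg]
    rw [h3]
    nth_rewrite 1 [hdec b]
    simp [h1, h2, sub_eq_add_neg]
  have hT : ∀ b, ∃ T : H →L[ℂ] H, ∀ v w, ⟪ι v, T (ι w)⟫_ℂ = K b v w := fun b => by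
    obtain ⟨c, hc⟩ := hbdd b
    exact exists_clm_of_form hι (K b) hc
  choose T hT using hT
  let φ : V →ₗ[ℂ] (H →L[ℂ] H) :=
    { toFun := T
      map_add' := fun b b' => clm_eq_of_inner_denseRange hι fun v w => by
        simp [hT]
      map_smul' := fun a b => clm_eq_of_inner_denseRange hι fun v w => by
        simp [hT] }
  have hstar : ∀ b, φ (star b) = star (φ b) := fun b =>
    clm_eq_of_inner_denseRange hι fun v w => by
      rw [ContinuousLinearMap.star_eq_adjoint, ContinuousLinearMap.adjoint_inner_right,
        ← inner_conj_symm (φ b (ι v)) (ι w)]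
      exact (hT _ v w).trans ((hsym b w v).symm.trans (by rw [← hT b w v]; rfl))
  refine ⟨H, inferInstance, inferInstance, inferInstance, ι, φ, hT, ?_, hstar, ?_⟩
  · exact clm_eq_of_inner_denseRange hι fun v w => (hT e v w).trans (hιK v w).symm
  · intro n X hX
    refine mem_cstarCones_of_sum_inner_nonneg ?_ fun ξ => ?_
    · ext1 i j
      rw [Matrix.conjTranspose_apply, Matrix.map_apply, Matrix.map_apply, ← hstar,
        ← Matrix.conjTranspose_apply, hC.hermitian n X hX]
    · have hd : DenseRange fun (v : Fin n → F) (i : Fin n) => ι (v i) :=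
        DenseRange.piMap fun _ => hι
      -- Positivity is a closed condition on the column, so columns from the dense range of `ι`
      -- suffice; there it is the hypothesis on `K`.
      refine hd.induction_on ξ (isClosed_le (by fun_prop) ?_) fun v => ?_
      · simp only [matApply]
        fun_prop
      · convert hK n X hX v using 3 with i
        rw [matApply, inner_sum]
        exact Finset.sum_congr rfl fun j _ => hT _ _ _

open Classical in
theorem sum_positiveFormₗ_nonneg (hC : IsMatrixOrdered C) (n : ℕ)
    (X : Matrix (Fin n) (Fin n) V) (hX : X ∈ C n)
    (v : Fin n → Π₀ p : PositiveFunctionals C, Fin p.1 → ℂ) :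
    0 ≤ ∑ i, ∑ j, positiveFormₗ C (X i j) (v i) (v j) := by
  have h : ∀ i j, positiveFormₗ C (X i j) (v i) (v j) =
      ∑ p ∈ Finset.univ.biUnion fun i => (v i).support,
        p.2.1 (rankOneMatrix (X i j) (v i p) (v j p)) := fun i j =>
    positiveForm_eq_sum _ _ _
      (Finset.subset_biUnion_of_mem (fun i => (v i).support) (Finset.mem_univ i))
  simp only [h]
  rw [Finset.sum_congr rfl fun i _ => Finset.sum_comm, Finset.sum_comm]
  refine Finset.sum_nonneg fun p _ => ?_
  simp only [← map_sum]
  rw [sum_rankOneMatrix X fun i => v i p]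
  exact p.2.2 _ (hC.compression_mem _ _ _ X hX)

/-- The Choi–Effros theorem: an abstract operator system is completely order isomorphic to a
concrete one. -/
theorem exists_completeOrderEmbedding (hC : IsMatrixOrdered C)
    (he : IsArchimedeanMatrixOrderUnit C e) :
    ∃ (H : Type u) (_ : NormedAddCommGroup H) (_ : InnerProductSpace ℂ H) (_ : CompleteSpace H)
      (φ : V →ₗ[ℂ] (H →L[ℂ] H)), Function.Injective φ ∧ φ e = 1 ∧
      (∀ b, φ (star b) = star (φ b)) ∧
      ∀ n (X : Matrix (Fin n) (Fin n) V), X.map φ ∈ cstarCones (H →L[ℂ] H) n ↔ X ∈ C n := by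
  classical
  obtain ⟨H, _, _, _, ι, φ, hφ, hφe, hφs, hφC⟩ :=
    exists_representation_of_forms hC he.1 (positiveFormₗ C) (sum_positiveFormₗ_nonneg hC)
  have hmem : ∀ n (X : Matrix (Fin n) (Fin n) V), X.conjTranspose = X →
      X.map φ ∈ cstarCones (H →L[ℂ] H) n → X ∈ C n := by
    intro n X hX h
    by_contra hXn
    obtain ⟨s, hs, hsX⟩ := exists_positive_functional hC he hX hXn
    refine hsX ?_
    rw [← sum_positiveFormₗ_single X ⟨s, hs⟩]
    -- On the basis vectors in the summand of the separating `s`, positivity of `X.map φ` reads `s X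
    -- ≥ 0`, a contradiction.
    have h1 := sum_inner_nonneg_of_mem_cstarCones h fun i =>
      ι (DFinsupp.single (⟨n, s, hs⟩ : PositiveFunctionals C) (Pi.single i 1))
    simpa only [matApply, inner_sum, Matrix.map_apply, hφ] using h1
  have hinj0 : ∀ b, star b = b → φ b = 0 → b = 0 := by
    intro b hb h
    have h1 : Matrix.of (fun _ _ : Fin 1 => b) ∈ C 1 := by
      refine hmem 1 _ (by ext; simp [hb]) ?_
      convert zero_mem_cstarCones 1
      ext1 i j
      simp [h]
    have h2 : -Matrix.of (fun _ _ : Fin 1 => b) ∈ C 1 := by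
      refine hmem 1 _ (by ext; simp [hb]) ?_
      convert zero_mem_cstarCones 1
      ext1 i j
      simp [h]
    exact congrFun (congrFun (hC.proper 1 _ h1 h2) 0) 0
  have hinj : Function.Injective φ := by
    rw [injective_iff_map_eq_zero]
    intro b hb
    have hbs : φ (star b) = 0 := by rw [hφs, hb, star_zero]
    -- Properness only settles hermitian elements, so it is applied to `b + b⋆` and `i(b - b⋆)`.
    have h1 : b + star b = 0 := hinj0 _ (by rw [star_add, star_star, add_comm])
      (by rw [map_add, hb, hbs, add_zero])
    have h2 : Complex.I • (b - star b) = 0 := hinj0 _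
      (by rw [star_smul, star_sub, star_star, Complex.star_def, Complex.conj_I, neg_smul,
        ← smul_neg, neg_sub])
      (by rw [map_smul, map_sub, hb, hbs, sub_zero, smul_zero])
    rw [smul_eq_zero_iff_right Complex.I_ne_zero, sub_eq_zero] at h2
    rw [← h2, ← two_smul ℂ, smul_eq_zero_iff_right two_ne_zero] at h1
    exact h1
  refine ⟨H, inferInstance, inferInstance, inferInstance, φ, hinj, hφe, hφs,
    fun n X => ⟨fun h => hmem n X ?_ h, hφC n X⟩⟩
  -- `X` is not assumed hermitian: this follows from `X.map φ` being hermitian, as `φ` is injective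
  -- and preserves the involution.
  ext i j
  apply hinj
  have h1 := congrFun (congrFun (cstarCones_hermitian h) i) j
  rw [Matrix.conjTranspose_apply, hφs]
  exact h1

end Representation

/-! ### Order norms and complete order embeddings. -/

section OrderNorm

variable {V : Type u} [AddCommGroup V] [Module ℂ V] {W : Type v} [AddCommGroup W] [Module ℂ W]

theorem map_ampUnit (φ : V →ₗ[ℂ] W) (e : V) (n : ℕ) :
    (ampUnit e n).map φ = ampUnit (φ e) n :=
  Matrix.diagonal_map (map_zero φ)

theorem map_smul_ampUnit_add (φ : V →ₗ[ℂ] W) (e : V) {n : ℕ} (r : ℂ)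
    (X : Matrix (Fin n) (Fin n) V) :
    (r • ampUnit e n + X).map φ = r • ampUnit (φ e) n + X.map φ := by
  rw [← map_ampUnit]
  ext i j
  simp

variable [StarAddMonoid V] [StarAddMonoid W]

theorem map_normBlock (φ : V →ₗ[ℂ] W) (hφ : ∀ b, φ (star b) = star (φ b)) (e : V) {n : ℕ}
    (X : Matrix (Fin n) (Fin n) V) (r : ℝ) :
    (normBlock e X r).map φ = normBlock (φ e) (X.map φ) r := by
  have h1 : ((r : ℂ) • ampUnit e n).map φ = (r : ℂ) • ampUnit (φ e) n := by
    rw [← map_ampUnit]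
    ext i j
    simp
  have h2 : X.conjTranspose.map φ = (X.map φ).conjTranspose := by
    ext i j
    simp [hφ]
  rw [normBlock, normBlock, Matrix.reindex_apply, Matrix.reindex_apply, ← Matrix.submatrix_map,
    Matrix.fromBlocks_map, h1, h2]

theorem normBlock_add (e : V) {n : ℕ} (X : Matrix (Fin n) (Fin n) V) (r t : ℝ) :
    normBlock e X (r + t) = (t : ℂ) • ampUnit e (n + n) + normBlock e X r := by
  have h : ampUnit e (n + n) = (Matrix.reindex finSumFinEquiv finSumFinEquiv)
      (Matrix.fromBlocks (ampUnit e n) 0 0 (ampUnit e n)) := by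
    rw [ampUnit, ampUnit, Matrix.fromBlocks_diagonal, Matrix.reindex_apply,
      Matrix.submatrix_diagonal_equiv]
    congr 1
    funext i
    simp only [Function.comp_apply]
    cases finSumFinEquiv.symm i <;> rfl
  have key : Matrix.fromBlocks (((r + t : ℝ) : ℂ) • ampUnit e n) X X.conjTranspose
      (((r + t : ℝ) : ℂ) • ampUnit e n) =
      (t : ℂ) • Matrix.fromBlocks (ampUnit e n) 0 0 (ampUnit e n) +
        Matrix.fromBlocks ((r : ℂ) • ampUnit e n) X X.conjTranspose ((r : ℂ) • ampUnit e n) := by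
    rw [Matrix.fromBlocks_smul, Matrix.fromBlocks_add]
    simp [add_smul, add_comm]
  rw [normBlock, normBlock, h, key]
  rfl

/-- The case `r = 0` is included, where one cannot divide by `r`: `r` is enlarged by `t > 0`, which
adds a positive multiple of the unit to the block matrix. -/
theorem norm_le_of_normBlock_mem {𝔄 : Type u} [CStarAlgebra 𝔄] [PartialOrder 𝔄]
    [StarOrderedRing 𝔄] {n : ℕ} {T : Matrix (Fin n) (Fin n) 𝔄} {r : ℝ} (hr : 0 ≤ r)
    (h : normBlock 1 T r ∈ cstarCones 𝔄 (n + n)) : ‖CStarMatrix.ofMatrix T‖ ≤ r := by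
  refine le_of_forall_pos_le_add fun t ht => ?_
  refine norm_le_of_normBlock_mem_cstarCones (by positivity) ?_
  rw [normBlock_add]
  exact add_mem_cstarCones
    (smul_mem_cstarCones ht.le
      (ampUnit_mem isMatrixOrdered_cstarCones isArchimedeanMatrixOrderUnit_cstarCones.1 _)) h

variable {𝔄 : Type v} [CStarAlgebra 𝔄] [PartialOrder 𝔄] [StarOrderedRing 𝔄]
  {C : MatrixCones V} {e : V}

theorem norm_le_orderNorm_set (φ : V →ₗ[ℂ] 𝔄) (hφe : φ e = 1)
    (hφ : ∀ b, φ (star b) = star (φ b)) (hφC : IsCompletelyPositive C (cstarCones 𝔄) φ) {n : ℕ}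
    (X : Matrix (Fin n) (Fin n) V) {r : ℝ} (hr : 0 ≤ r) (h : normBlock e X r ∈ C (n + n)) :
    ‖CStarMatrix.ofMatrix (X.map φ)‖ ≤ r := by
  have h1 := hφC _ _ h
  rw [map_normBlock φ hφ, hφe] at h1
  exact norm_le_of_normBlock_mem hr h1

theorem normBlock_mem_of_norm_le (φ : V →ₗ[ℂ] 𝔄) (hφe : φ e = 1)
    (hφ : ∀ b, φ (star b) = star (φ b))
    (hφC : ∀ n (X : Matrix (Fin n) (Fin n) V), X.map φ ∈ cstarCones 𝔄 n ↔ X ∈ C n) {n : ℕ}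
    (X : Matrix (Fin n) (Fin n) V) {r : ℝ} (hr : 0 < r)
    (h : ‖CStarMatrix.ofMatrix (X.map φ)‖ ≤ r) : normBlock e X r ∈ C (n + n) := by
  rw [← hφC, map_normBlock φ hφ, hφe]
  exact normBlock_mem_cstarCones_of_norm_le hr h

/-- A unital complete order embedding is completely isometric for the order norms. -/
theorem norm_map_eq_orderNorm (φ : V →ₗ[ℂ] 𝔄) (hφe : φ e = 1)
    (hφ : ∀ b, φ (star b) = star (φ b))
    (hφC : ∀ n (X : Matrix (Fin n) (Fin n) V), X.map φ ∈ cstarCones 𝔄 n ↔ X ∈ C n) {n : ℕ}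
    (X : Matrix (Fin n) (Fin n) V) :
    ‖CStarMatrix.ofMatrix (X.map φ)‖ = orderNorm C e n X := by
  have hmem : ∀ t : ℝ, 0 < t → 0 ≤ ‖CStarMatrix.ofMatrix (X.map φ)‖ + t ∧
      normBlock e X (‖CStarMatrix.ofMatrix (X.map φ)‖ + t) ∈ C (n + n) := fun t ht =>
    ⟨by positivity, normBlock_mem_of_norm_le φ hφe hφ hφC X (by positivity) (by linarith)⟩
  apply le_antisymm
  · refine le_csInf ⟨_, hmem 1 one_pos⟩ ?_
    rintro r ⟨hr, h⟩
    exact norm_le_orderNorm_set φ hφe hφ (fun n X => (hφC n X).2) X hr h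
  · refine le_of_forall_pos_le_add fun t ht => ?_
    exact csInf_le ⟨0, fun r hr => hr.1⟩ (hmem t ht)

end OrderNorm

/-! ### Completely positive functionals as states. -/

section State

variable {V : Type u} [AddCommGroup V] [Module ℂ V] [StarAddMonoid V] [StarModule ℂ V]
  {C : MatrixCones V} {e : V}

/-- Unital completely positive functionals are states. -/
theorem isOperatorSystemState_of_isCompletelyPositive (hC : IsMatrixOrdered C)
    (he : IsArchimedeanMatrixOrderUnit C e) (f : V →ₗ[ℂ] ℂ) (hfe : f e = 1)
    (hf : ∀ b, f (star b) = star (f b)) (hfC : IsCompletelyPositive C (cstarCones ℂ) f) :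
    IsOperatorSystemState C e f := by
  refine ⟨fun b hb => ?_, hfe, fun b => ?_⟩
  · obtain ⟨Y, hY⟩ := hfC 1 _ hb
    have h := congrFun (congrFun hY 0) 0
    simp only [Matrix.map_apply, Matrix.of_apply, Matrix.mul_apply, Finset.univ_unique,
      Finset.sum_singleton, Matrix.conjTranspose_apply] at h
    rw [h]
    exact star_mul_self_nonneg _
  -- The embedding only shows that some `r` is admissible in the infimum; for an empty set `sInf`
  -- would be `0` and the bound could fail.
  · obtain ⟨H, _, _, _, φ, -, hφe, hφs, hφC⟩ := exists_completeOrderEmbedding hC he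
    refine le_csInf ⟨‖CStarMatrix.ofMatrix ((Matrix.of fun _ _ : Fin 1 => b).map φ)‖ + 1,
      by positivity, normBlock_mem_of_norm_le φ hφe hφs hφC _ (by positivity) (by linarith)⟩ ?_
    rintro r ⟨hr, h⟩
    have h1 := norm_le_orderNorm_set f hfe hf hfC _ hr h
    rwa [← norm_ofMatrix_one_by_one (f b)]

end State

/-! ### Compression, polarization, and the cones on the reduced space. -/

section Compression

variable {V : Type u} [AddCommGroup V] [Module ℂ V] {n m : ℕ}

theorem compression_add (A : Matrix (Fin n) (Fin m) ℂ) (X Y : Matrix (Fin n) (Fin n) V) :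
    compression A (X + Y) = compression A X + compression A Y := by
  ext i j
  simp [compression, Finset.sum_add_distrib]

theorem compression_smul (A : Matrix (Fin n) (Fin m) ℂ) (r : ℂ) (X : Matrix (Fin n) (Fin n) V) :
    compression A (r • X) = r • compression A X := by
  ext i j
  simp [compression, Finset.smul_sum, smul_smul, mul_comm]

theorem map_compression {W : Type v} [AddCommGroup W] [Module ℂ W] (φ : V →ₗ[ℂ] W)
    (A : Matrix (Fin n) (Fin m) ℂ) (X : Matrix (Fin n) (Fin n) V) :
    (compression A X).map φ = compression A (X.map φ) := by
  ext i j
  simp [compression]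

end Compression

theorem form_eq_zero_of_diag_eq_zero {F : Type*} [AddCommGroup F] [Module ℂ F]
    (S : F →ₗ⋆[ℂ] F →ₗ[ℂ] ℂ) (h : ∀ v, S v v = 0) (v w : F) : S v w = 0 := by
  have h1 := h (v + w)
  have h2 := h (v + Complex.I • w)
  simp only [map_add, LinearMap.add_apply, h, LinearMap.map_smulₛₗ, LinearMap.smul_apply,
    smul_eq_mul, Complex.conj_I, RingHom.id_apply, zero_add, add_zero, mul_zero, neg_mul] at h1 h2
  have h3 : Complex.I * (2 * S v w) = 0 := by linear_combination h2 + Complex.I * h1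
  simpa using h3

section ReducedCones

variable {A : Type u} [CStarAlgebra A] {ω : CState (Chain A)}

theorem star_quotMap (a : rightHalf A) : star (quotMap ω a) = quotMap ω (star a) := rfl

theorem conjTranspose_map_quotMap {n : ℕ} (a : Matrix (Fin n) (Fin n) (rightHalf A)) :
    (a.map (quotMap ω)).conjTranspose = a.conjTranspose.map (quotMap ω) := rfl

theorem exists_map_quotMap_eq {n : ℕ} (X : Matrix (Fin n) (Fin n) (Reduced ω)) :
    ∃ a : Matrix (Fin n) (Fin n) (rightHalf A), a.map (quotMap ω) = X := by
  choose a ha using fun i j => quotMap_surjective ω (X i j)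
  exact ⟨Matrix.of a, by ext i j; exact ha i j⟩

/-- A matrix over `B_ω` is in the cone if it has lifts that are positive up to every `ε > 0`. -/
theorem mem_reducedCones_iff {n : ℕ} (X : Matrix (Fin n) (Fin n) (Reduced ω)) :
    X ∈ reducedCones ω n ↔ ∀ ε : ℝ, 0 < ε → ∃ b : Matrix (Fin n) (Fin n) (rightHalf A),
      b.map (quotMap ω) = X ∧ (ε : ℂ) • ampUnit 1 n + b ∈ cstarCones (rightHalf A) n := by
  constructor
  · rintro ⟨a, rfl, h⟩ ε hε
    obtain ⟨k, hk, h1⟩ := h ε hε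
    refine ⟨a + k, ?_, h1⟩
    ext1 i j
    refine (quotMap_eq_iff ω _ _).2 ?_
    rw [Matrix.add_apply, add_sub_cancel_left]
    exact hk i j
  · intro h
    obtain ⟨a, ha⟩ := exists_map_quotMap_eq X
    refine ⟨a, ha.symm, fun ε hε => ?_⟩
    obtain ⟨b, hb, h1⟩ := h ε hε
    refine ⟨b - a, fun i j => ?_, by rwa [add_sub_cancel]⟩
    rw [Matrix.sub_apply, ← quotMap_eq_iff]
    exact congrFun (congrFun (hb.trans ha.symm) i) j

/-- The sesquilinear form `(x, y) ↦ ∑ ω(xᵢ⋆ yⱼ aᵢⱼ)` on columns of elements of `A_L`. -/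
noncomputable def leftForm (ω : CState (Chain A)) {n : ℕ}
    (a : Matrix (Fin n) (Fin n) (rightHalf A)) :
    (Fin n → leftHalf A) →ₗ⋆[ℂ] (Fin n → leftHalf A) →ₗ[ℂ] ℂ :=
  LinearMap.mk₂'ₛₗ (starRingEnd ℂ) (RingHom.id ℂ)
    (fun x y => ∑ i, ∑ j, ω.toFun (star (x i : Chain A) * (y j : Chain A) * (a i j : Chain A)))
    (fun x x' y => by simp [add_mul, Finset.sum_add_distrib])
    (fun c x y => by simp [Finset.mul_sum])
    (fun x y y' => by simp [add_mul, mul_add, Finset.sum_add_distrib])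
    (fun c x y => by simp [Finset.mul_sum])

theorem leftForm_apply {n : ℕ} (a : Matrix (Fin n) (Fin n) (rightHalf A))
    (x y : Fin n → leftHalf A) : leftForm ω a x y =
      ∑ i, ∑ j, ω.toFun (star (x i : Chain A) * (y j : Chain A) * (a i j : Chain A)) := rfl

theorem leftForm_add {n : ℕ} (a b : Matrix (Fin n) (Fin n) (rightHalf A))
    (x y : Fin n → leftHalf A) : leftForm ω (a + b) x y = leftForm ω a x y + leftForm ω b x y := by
  simp [leftForm_apply, mul_add, Finset.sum_add_distrib]

theorem leftForm_smul {n : ℕ} (c : ℂ) (a : Matrix (Fin n) (Fin n) (rightHalf A))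
    (x y : Fin n → leftHalf A) : leftForm ω (c • a) x y = c * leftForm ω a x y := by
  simp [leftForm_apply, Finset.mul_sum]

/-- Each product `xᵢ⋆ yⱼ` lies in `A_L`, and `K_ω` is what all functionals `ω(z ·)` with `z ∈ A_L`
annihilate. -/
theorem leftForm_eq_of_map_quotMap_eq {n : ℕ} {a b : Matrix (Fin n) (Fin n) (rightHalf A)}
    (h : a.map (quotMap ω) = b.map (quotMap ω)) (x y : Fin n → leftHalf A) :
    leftForm ω a x y = leftForm ω b x y := by
  rw [leftForm_apply, leftForm_apply]
  refine Finset.sum_congr rfl fun i _ => Finset.sum_congr rfl fun j _ => ?_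
  have h1 := (quotMap_eq_iff ω _ _).1 (congrFun (congrFun h i) j)
  have h2 := h1 (star (x i : Chain A) * (y j : Chain A)) (mul_mem (star_mem (x i).2) (y j).2)
  rw [AddSubgroupClass.coe_sub, mul_sub, map_sub, sub_eq_zero] at h2
  exact h2

/-- Commuting `A_L` past `A_R` rewrites the form of `Y⋆Y` as `∑ₖ ω(zₖ⋆ zₖ)` with `zₖ = ∑ᵢ Yₖᵢ xᵢ`.
-/
theorem leftForm_nonneg {n : ℕ} {a : Matrix (Fin n) (Fin n) (rightHalf A)}
    (ha : a ∈ cstarCones (rightHalf A) n) (x : Fin n → leftHalf A) : 0 ≤ leftForm ω a x x := by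
  obtain ⟨Y, rfl⟩ := ha
  have h : leftForm ω (Y.conjTranspose * Y) x x = ∑ k, ω.toFun
      (star (∑ i, (Y k i : Chain A) * x i) * ∑ j, (Y k j : Chain A) * x j) := by
    simp only [leftForm_apply, Matrix.mul_apply, star_sum, Finset.sum_mul, Finset.mul_sum, map_sum,
      AddSubmonoidClass.coe_finsetSum]
    rw [Finset.sum_congr rfl fun i _ => Finset.sum_comm, Finset.sum_comm]
    refine Finset.sum_congr rfl fun k _ => ?_
    rw [Finset.sum_comm]
    refine Finset.sum_congr rfl fun j _ => Finset.sum_congr rfl fun i _ => congrArg _ ?_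
    have h1 := left_right_commute (x j).2 (Y k j).2
    have h2 := left_right_commute (x j).2 (star_mem (Y k i).2)
    change star (x i : Chain A) * (x j : Chain A) * (star (Y k i : Chain A) * (Y k j : Chain A)) = _
    rw [star_mul, mul_assoc, mul_assoc, ← h1, ← mul_assoc (x j : Chain A), h2, mul_assoc]
  rw [h]
  exact Finset.sum_nonneg fun k _ => ω.nonneg _

theorem leftForm_nonneg_of_mem_reducedCones {n : ℕ} {a : Matrix (Fin n) (Fin n) (rightHalf A)}
    (ha : a.map (quotMap ω) ∈ reducedCones ω n) (x : Fin n → leftHalf A) :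
    0 ≤ leftForm ω a x x := by
  have hc : Filter.Tendsto
      (fun r : ℝ => (r : ℂ) * leftForm ω (ampUnit 1 n) x x + leftForm ω a x x)
      (nhdsWithin 0 (Set.Ioi 0)) (nhds (leftForm ω a x x)) := by
    have h : Continuous fun r : ℝ =>
        (r : ℂ) * leftForm ω (ampUnit 1 n) x x + leftForm ω a x x := by fun_prop
    have h0 := h.tendsto 0
    rw [Complex.ofReal_zero, zero_mul, zero_add] at h0
    exact h0.mono_left nhdsWithin_le_nhds
  refine ge_of_tendsto hc ?_
  filter_upwards [self_mem_nhdsWithin] with r hr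
  obtain ⟨b, hb, h⟩ := (mem_reducedCones_iff _).1 ha r hr
  rw [← leftForm_eq_of_map_quotMap_eq hb x x, ← leftForm_smul, ← leftForm_add]
  exact leftForm_nonneg h x

theorem map_quotMap_eq_zero_of_leftForm {n : ℕ} {a : Matrix (Fin n) (Fin n) (rightHalf A)}
    (h : ∀ x, leftForm ω a x x = 0) : a.map (quotMap ω) = 0 := by
  ext1 i j
  rw [Matrix.map_apply, Matrix.zero_apply, ← map_zero (quotMap ω), quotMap_eq_iff, sub_zero]
  intro y hy
  -- After polarization, `1` in slot `i` and `y` in slot `j` isolate `ω(y aᵢⱼ)`.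
  have h1 := form_eq_zero_of_diag_eq_zero _ h (Pi.single i 1) (Pi.single j ⟨y, hy⟩)
  rw [leftForm_apply, Finset.sum_eq_single i, Finset.sum_eq_single j] at h1
  · simpa using h1
  · intro k _ hk
    simp [Pi.single_eq_of_ne hk]
  · simp
  · intro k _ hk
    simp [Pi.single_eq_of_ne hk]
  · simp

theorem isMatrixOrdered_reducedCones : IsMatrixOrdered (reducedCones ω) where
  hermitian n X hX := by
    obtain ⟨b, rfl, h⟩ := (mem_reducedCones_iff X).1 hX 1 one_pos
    have h1 := cstarCones_hermitian h
    rw [Complex.ofReal_one, one_smul, Matrix.conjTranspose_add,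
      conjTranspose_ampUnit (star_one _), add_right_inj] at h1
    rw [conjTranspose_map_quotMap, h1]
  zero_mem n := (mem_reducedCones_iff _).2 fun ε hε => ⟨0, by ext; simp, by
    rw [add_zero]
    exact smul_mem_cstarCones hε.le
      (ampUnit_mem isMatrixOrdered_cstarCones isArchimedeanMatrixOrderUnit_cstarCones.1 n)⟩
  add_mem n X hX Y hY := (mem_reducedCones_iff _).2 fun ε hε => by
    obtain ⟨b, rfl, hb⟩ := (mem_reducedCones_iff X).1 hX (ε / 2) (half_pos hε)
    obtain ⟨c, rfl, hc⟩ := (mem_reducedCones_iff Y).1 hY (ε / 2) (half_pos hε)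
    refine ⟨b + c, by ext; simp, ?_⟩
    convert add_mem_cstarCones hb hc using 1
    rw [add_add_add_comm, ← add_smul, ← Complex.ofReal_add, add_halves]
  smul_mem n r hr X hX := (mem_reducedCones_iff _).2 fun ε hε => by
    -- Dividing by `r + 1` allows `r = 0`; the missing share `ε / (r + 1)` of the unit is added
    -- separately.
    obtain ⟨b, rfl, hb⟩ := (mem_reducedCones_iff X).1 hX (ε / (r + 1)) (by positivity)
    have h1 := smul_mem_cstarCones hr hb
    have h2 := smul_mem_cstarCones (r := ε / (r + 1)) (by positivity)
      (ampUnit_mem (isMatrixOrdered_cstarCones (𝔄 := rightHalf A))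
        isArchimedeanMatrixOrderUnit_cstarCones.1 n)
    refine ⟨(r : ℂ) • b, by ext; simp, ?_⟩
    convert add_mem_cstarCones h2 h1 using 1
    rw [smul_add, ← add_assoc, smul_smul, ← add_smul, ← Complex.ofReal_mul, ← Complex.ofReal_add]
    congr 3
    field_simp
    ring
  proper n X hX hX' := by
    obtain ⟨a, rfl⟩ := exists_map_quotMap_eq X
    refine map_quotMap_eq_zero_of_leftForm fun x => ?_
    have h1 := leftForm_nonneg_of_mem_reducedCones hX x
    have h2 : -(a.map (quotMap ω)) = ((-1 : ℂ) • a).map (quotMap ω) := by ext; simp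
    rw [h2] at hX'
    have h3 := leftForm_nonneg_of_mem_reducedCones hX' x
    rw [leftForm_smul, neg_one_mul, neg_nonneg] at h3
    exact le_antisymm h3 h1
  compression_mem n m B X hX := (mem_reducedCones_iff _).2 fun ε hε => by
    have hu := isArchimedeanMatrixOrderUnit_cstarCones (𝔄 := rightHalf A)
    have hR := isMatrixOrdered_cstarCones (𝔄 := rightHalf A)
    -- Compression does not preserve the unit. Since `B⋆B ≤ r`, slack `ε / r` before compressing
    -- costs at most `ε` afterwards.
    obtain ⟨r, hr, h⟩ := hu.1.2 m (compression B (ampUnit 1 n))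
      (hR.hermitian _ _ (hR.compression_mem _ _ B _ (ampUnit_mem hR hu.1 n)))
    obtain ⟨b, rfl, hb⟩ := (mem_reducedCones_iff X).1 hX (ε / r) (by positivity)
    refine ⟨compression B b, map_compression _ _ _, ?_⟩
    have h1 := hR.compression_mem _ _ B _ hb
    have h2 := smul_mem_cstarCones (r := ε / r) (by positivity) h
    convert add_mem_cstarCones h2 h1 using 1
    have hr' : ε / r * r = ε := by field_simp
    rw [compression_add, compression_smul, smul_sub, smul_smul, ← Complex.ofReal_mul, hr']
    abel

theorem isCompletelyPositive_quotMap :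
    IsCompletelyPositive (cstarCones (rightHalf A)) (reducedCones ω) (quotMap ω) :=
  fun n X hX => (mem_reducedCones_iff _).2 fun _ hε => ⟨X, rfl, add_mem_cstarCones
    (smul_mem_cstarCones hε.le
      (ampUnit_mem isMatrixOrdered_cstarCones isArchimedeanMatrixOrderUnit_cstarCones.1 n)) hX⟩

theorem isArchimedeanMatrixOrderUnit_reducedUnit :
    IsArchimedeanMatrixOrderUnit (reducedCones ω) (reducedUnit ω) := by
  refine ⟨⟨by rw [reducedUnit, star_quotMap, star_one], fun n X hX => ?_⟩, fun n X _ h => ?_⟩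
  · obtain ⟨a, rfl⟩ := exists_map_quotMap_eq X
    -- A lift of a hermitian class need not be hermitian; its hermitian part is another lift of the
    -- same class.
    obtain ⟨r, hr, h⟩ := (isArchimedeanMatrixOrderUnit_cstarCones (𝔄 := rightHalf A)).1.2 n
      ((2⁻¹ : ℂ) • (a + a.conjTranspose)) (by
        rw [Matrix.conjTranspose_smul, Matrix.conjTranspose_add,
          Matrix.conjTranspose_conjTranspose, add_comm]
        simp)
    refine ⟨r, hr, ?_⟩
    convert isCompletelyPositive_quotMap (ω := ω) n _ h using 1
    have h1 : ((2⁻¹ : ℂ) • (a + a.conjTranspose)).map (quotMap ω) = a.map (quotMap ω) := by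
      have h2 : ((2⁻¹ : ℂ) • (a + a.conjTranspose)).map (quotMap ω) =
          (2⁻¹ : ℂ) • (a.map (quotMap ω) + a.conjTranspose.map (quotMap ω)) := by
        ext i j
        simp
      rw [h2, ← conjTranspose_map_quotMap, hX, ← two_smul ℂ, smul_smul,
        inv_mul_cancel₀ two_ne_zero, one_smul]
    rw [sub_eq_add_neg, sub_eq_add_neg, map_smul_ampUnit_add]
    nth_rewrite 1 [← h1]
    congr 1
  · refine (mem_reducedCones_iff _).2 fun ε hε => ?_
    obtain ⟨b, hb, h1⟩ := (mem_reducedCones_iff _).1 (h (ε / 2) (half_pos hε)) (ε / 2)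
      (half_pos hε)
    -- `b` lifts `(ε / 2) e + X`, so subtracting `ε / 2` gives a lift of `X`; adding `ε` to it
    -- leaves `ε / 2 + b`, which is positive.
    refine ⟨((-(ε / 2) : ℝ) : ℂ) • ampUnit 1 n + b, ?_, ?_⟩
    · rw [map_smul_ampUnit_add, hb, ← add_assoc, ← reducedUnit, ← add_smul,
        ← Complex.ofReal_add, neg_add_cancel, Complex.ofReal_zero, zero_smul, zero_add]
    · rwa [← add_assoc, ← add_smul, ← Complex.ofReal_add, ← sub_eq_add_neg, sub_half]

/-- Unital completely positive maps that vanish on the entanglement kernel descend to the reduced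
space. -/
theorem isCompletelyPositive_descend {T : Type v} [AddCommGroup T] [Module ℂ T] [StarAddMonoid T]
    [StarModule ℂ T] {D : MatrixCones T} {e : T} (hD : IsMatrixOrdered D)
    (he : IsArchimedeanMatrixOrderUnit D e) (φ : rightHalf A →ₗ[ℂ] T)
    (hφ : ∀ k ∈ entKernel ω, φ k = 0) (hφ1 : φ 1 = e)
    (hφC : IsCompletelyPositive (cstarCones (rightHalf A)) D φ) :
    IsCompletelyPositive (reducedCones ω) D (descend ω φ hφ) := by
  intro n X hX
  have h : ∀ r : ℝ, 0 < r → (r : ℂ) • ampUnit e n + X.map (descend ω φ hφ) ∈ D n := by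
    intro r hr
    obtain ⟨b, rfl, hb⟩ := (mem_reducedCones_iff X).1 hX r hr
    have h1 := hφC n _ hb
    rwa [map_smul_ampUnit_add, hφ1] at h1
  -- The `r` needed to lift positively upstairs is removed by the Archimedean property of the
  -- target.
  refine he.2 n _ ?_ h
  have h1 := hD.hermitian n _ (h 1 one_pos)
  rwa [Complex.ofReal_one, one_smul, Matrix.conjTranspose_add, conjTranspose_ampUnit he.1.1,
    add_right_inj] at h1

theorem isCompletelyPositive_restrictRight :
    IsCompletelyPositive (cstarCones (rightHalf A)) (cstarCones ℂ) (restrictRight ω) := by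
  rintro n _ ⟨Y, rfl⟩
  have hpos : ((Y.conjTranspose * Y).map (restrictRight ω)).PosSemidef := by
    refine Matrix.PosSemidef.of_dotProduct_mulVec_nonneg ?_ fun c => ?_
    · ext i j
      have h := ω.map_star ((Y.conjTranspose * Y) j i : rightHalf A)
      have h2 := congrFun (congrFun (Matrix.isHermitian_conjTranspose_mul_self Y) i) j
      rw [Matrix.conjTranspose_apply] at h2
      rw [Matrix.conjTranspose_apply, Matrix.map_apply, Matrix.map_apply, ← h2]
      exact h.symm
    -- With scalar columns from `A_L`, the left form is the quadratic form of the matrix `[ω(aᵢⱼ)]`.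
    · have h := leftForm_nonneg (ω := ω) ⟨Y, rfl⟩ fun i => algebraMap ℂ (leftHalf A) (c i)
      convert h using 1
      rw [leftForm_apply]
      simp only [dotProduct, Matrix.mulVec, Finset.mul_sum]
      refine Finset.sum_congr rfl fun i _ => Finset.sum_congr rfl fun j _ => ?_
      rw [show ((algebraMap ℂ (leftHalf A) (c i) : leftHalf A) : Chain A) =
        algebraMap ℂ (Chain A) (c i) from rfl,
        show ((algebraMap ℂ (leftHalf A) (c j) : leftHalf A) : Chain A) =
        algebraMap ℂ (Chain A) (c j) from rfl, ← algebraMap_star_comm, ← map_mul,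
        ← Algebra.smul_def, map_smul, smul_eq_mul, Pi.star_apply, mul_assoc, mul_comm _ (c j)]
      rfl
  obtain ⟨m, v, hv⟩ := Matrix.posSemidef_iff_eq_sum_vecMulVec.1 hpos
  rw [hv]
  convert conjTranspose_mul_self_mem_cstarCones (Matrix.of fun i j => star (v i j)) using 1
  ext i j
  simp [Matrix.sum_apply, Matrix.mul_apply, Matrix.vecMulVec_apply]

theorem isCompletelyPositive_reducedFunctional :
    IsCompletelyPositive (reducedCones ω) (cstarCones ℂ) (reducedFunctional ω) :=
  isCompletelyPositive_descend isMatrixOrdered_cstarCones isArchimedeanMatrixOrderUnit_cstarCones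
    _ _ ω.map_one isCompletelyPositive_restrictRight

theorem reducedFunctional_star (b : Reduced ω) :
    reducedFunctional ω (star b) = star (reducedFunctional ω b) := by
  obtain ⟨a, rfl⟩ := quotMap_surjective ω b
  exact ω.map_star a

end ReducedCones

end SpinChain

theorem mainTheorem3 {A : Type u} [CStarAlgebra A] (ω : SpinChain.CState (SpinChain.Chain A)) :
    -- `(B_ω, {C_n})` is a matrix-ordered `⋆`-space with Archimedean matrix order unit `1 + K_ω`
    (SpinChain.IsMatrixOrdered (SpinChain.reducedCones ω) ∧
      SpinChain.IsArchimedeanMatrixOrderUnit (SpinChain.reducedCones ω)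
        (SpinChain.reducedUnit ω)) ∧
    -- the quotient map is unital and completely positive
    (SpinChain.quotMap ω 1 = SpinChain.reducedUnit ω ∧
      SpinChain.IsCompletelyPositive (SpinChain.cstarCones (SpinChain.rightHalf A))
        (SpinChain.reducedCones ω) (SpinChain.quotMap ω)) ∧
    -- concrete representation as an operator system on a Hilbert space, unital and isometric
    (∃ (H : Type u) (_ : NormedAddCommGroup H) (_ : InnerProductSpace ℂ H) (_ : CompleteSpace H)
        (S : Submodule ℂ (H →L[ℂ] H)) (φ : SpinChain.Reduced ω ≃ₗ[ℂ] S),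
      SpinChain.IsOperatorSystem S ∧
      (φ (SpinChain.reducedUnit ω) : H →L[ℂ] H) = 1 ∧
      (∀ b, (φ (star b) : H →L[ℂ] H) = star (φ b : H →L[ℂ] H)) ∧
      SpinChain.IsCompletelyPositive (SpinChain.reducedCones ω) (SpinChain.inheritedCones S)
        φ.toLinearMap ∧
      SpinChain.IsCompletelyPositive (SpinChain.inheritedCones S) (SpinChain.reducedCones ω)
        φ.symm.toLinearMap ∧
      (∀ b, ‖(φ b : H →L[ℂ] H)‖ = SpinChain.orderNorm (SpinChain.reducedCones ω)
        (SpinChain.reducedUnit ω) 1 (Matrix.of fun _ _ => b)) ∧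
      (∀ (n : ℕ) (X : Matrix (Fin n) (Fin n) (SpinChain.Reduced ω)),
        ‖CStarMatrix.ofMatrix (X.map fun b => (φ b : H →L[ℂ] H))‖ =
          SpinChain.orderNorm (SpinChain.reducedCones ω) (SpinChain.reducedUnit ω) n X)) ∧
    -- unital completely positive maps that vanish on the kernel descend to such maps
    (∀ (T : Type v) [AddCommGroup T] [Module ℂ T] [StarAddMonoid T] [StarModule ℂ T]
        (D : SpinChain.MatrixCones T) (e : T), SpinChain.IsMatrixOrdered D →
        SpinChain.IsArchimedeanMatrixOrderUnit D e →
      ∀ (φ : SpinChain.rightHalf A →ₗ[ℂ] T) (hφ : ∀ k ∈ SpinChain.entKernel ω, φ k = 0),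
        φ 1 = e → SpinChain.IsCompletelyPositive (SpinChain.cstarCones (SpinChain.rightHalf A)) D φ →
        SpinChain.descend ω φ hφ (SpinChain.reducedUnit ω) = e ∧
          SpinChain.IsCompletelyPositive (SpinChain.reducedCones ω) D
            (SpinChain.descend ω φ hφ)) ∧
    -- the reduced functional is unital and completely positive, and a state
    (SpinChain.reducedFunctional ω (SpinChain.reducedUnit ω) = 1 ∧
      SpinChain.IsCompletelyPositive (SpinChain.reducedCones ω) (SpinChain.cstarCones ℂ)
        (SpinChain.reducedFunctional ω) ∧
      SpinChain.IsOperatorSystemState (SpinChain.reducedCones ω) (SpinChain.reducedUnit ω)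
        (SpinChain.reducedFunctional ω)) := by

  have hC := SpinChain.isMatrixOrdered_reducedCones (ω := ω)
  have he := SpinChain.isArchimedeanMatrixOrderUnit_reducedUnit (ω := ω)
  have hf := SpinChain.isCompletelyPositive_reducedFunctional (ω := ω)
  refine ⟨⟨hC, he⟩, ⟨rfl, SpinChain.isCompletelyPositive_quotMap⟩, ?_, ?_, ω.map_one, hf, ?_⟩
  · obtain ⟨H, _, _, _, φ, hinj, hφe, hφs, hφC⟩ :=
      SpinChain.exists_completeOrderEmbedding hC he
    have hnorm : ∀ (n : ℕ) (X : Matrix (Fin n) (Fin n) (SpinChain.Reduced ω)),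
        ‖CStarMatrix.ofMatrix (X.map φ)‖ = SpinChain.orderNorm (SpinChain.reducedCones ω)
          (SpinChain.reducedUnit ω) n X := fun n X =>
      SpinChain.norm_map_eq_orderNorm φ hφe hφs hφC X
    -- The operator system is the range of the embedding; complete positivity of the inverse is the
    -- direction of `hφC` that reflects positivity.
    refine ⟨H, inferInstance, inferInstance, inferInstance, LinearMap.range φ,
      LinearEquiv.ofInjective φ hinj, ⟨⟨_, hφe⟩, ?_⟩, hφe, hφs, fun n X hX => (hφC n X).2 hX,
      fun n X hX => ?_, fun b => ?_, hnorm⟩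
    · rintro _ ⟨b, rfl⟩
      exact ⟨star b, hφs b⟩
    · refine (hφC n _).1 ?_
      have h : (X.map (LinearEquiv.ofInjective φ hinj).symm).map φ =
          X.map fun s => (s : H →L[ℂ] H) := by
        ext1 i j
        exact congrArg Subtype.val ((LinearEquiv.ofInjective φ hinj).apply_symm_apply (X i j))
      exact h ▸ hX
    · rw [← hnorm]
      exact (SpinChain.norm_ofMatrix_one_by_one (φ b)).symm
  · intro T _ _ _ _ D e hD heD φ hφ hφ1 hφC
    exact ⟨hφ1, SpinChain.isCompletelyPositive_descend hD heD φ hφ hφ1 hφC⟩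
  · exact SpinChain.isOperatorSystemState_of_isCompletelyPositive hC he _ ω.map_one
      SpinChain.reducedFunctional_star hf
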